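/- Let $(X_j)_{j\ge1}$ be a stationary Gaussian process of real random variables with $EX_1=0$, $EX_1^2=1$ and covariances $EX_1X_{k+1}=k^{-D}L(k)$ for $k\ge1$, where $D>0$ and $L$ is slowly varying at infinity. Let $G:\mathbb R\to\mathbb R^p$ be measurable, $Y_j=G(X_j)$, and $F(x)=P(Y_1\le x)$ for $x\in[-\infty,\infty]^p$, where $\le$ is understood coordinatewise. Let $H_q(y)=(-1)^qe^{y^2/2}\frac{d^q}{dy^q}e^{-y^2/2}$ be the Hermite polynomials and $$J_q(x)=E\bigl[(1_{\{Y_1\le x\}}-F(x))H_q(X_1)\bigr],\qquad q\ge0,$$ let $m(x)$ be the smallest $q$ with $J_q(x)\ne0$ ($m(x)=\infty$ if there is none), and suppose that $m:=\min\{m(x):x\in\mathbb R^p\}$ is finite and $0<D<1/m$. Put $d_N^2=\operatorname{Var}\bigl(\sum_{j=1}^NH_m(X_j)\bigr)$, $d_N\ge 0$. Then there are constants $C,\kappa>0$ such that for all $N\ge1$ and all $0<\varepsilon\le1$ $$P\Bigl(\max_{1\le n\le N}\ \sup_{x\in[-\infty,\infty]^p}d_N^{-1}\Bigl|\sum_{j=1}^n\Bigl(1_{\{Y_j\le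 x\}}-F(x)-\frac{J_m(x)}{m!}H_m(X_j)\Bigr)\Bigr|>\varepsilon\Bigr)\le CN^{-\kappa}(1+\varepsilon^{-3}).$$ -/

import Mathlib

open MeasureTheory ProbabilityTheory Filter Topology
open scoped Nat

/-- A function that is slowly varying at infinity: measurable, eventually positive, and
`L (c t) / L t → 1` as `t → ∞` for every `c > 0`. -/
structure IsSlowlyVarying (L : ℝ → ℝ) : Prop where
  measurable : Measurable L
  eventually_pos : ∀ᶠ t in atTop, 0 < L t
  tendsto_ratio : ∀ c : ℝ, 0 < c → Tendsto (fun t => L (c * t) / L t) atTop (𝓝 1)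

/-- Strict stationarity of a sequence of real random variables: every shifted sequence has the
same law on `ℕ → ℝ` as the sequence itself. -/
def IsStationarySeq {Ω : Type*} [MeasurableSpace Ω] (X : ℕ → Ω → ℝ) (μ : Measure Ω) : Prop :=
  ∀ h : ℕ, IdentDistrib (fun ω (j : ℕ) => X (j + h) ω) (fun ω (j : ℕ) => X j ω) μ μ

/-- The value at `y` of the `n`-th (probabilists') Hermite polynomial,
`(-1)^n e^{y²/2} (dⁿ/dyⁿ) e^{-y²/2}`. -/
noncomputable def hermiteEval (n : ℕ) (y : ℝ) : ℝ :=
  Polynomial.aeval y (Polynomial.hermite n)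

/-- The set of points `y ∈ ℝᵖ` with `y ≤ x` coordinatewise, where `x ∈ [-∞, ∞]ᵖ`. -/
def lowerOrthant {p : ℕ} (x : Fin p → EReal) : Set (Fin p → ℝ) :=
  {y | ∀ i, (y i : EReal) ≤ x i}

/-- The indicator `1_{y ≤ x}`. -/
noncomputable def indLE {p : ℕ} (x : Fin p → EReal) (y : Fin p → ℝ) : ℝ :=
  (lowerOrthant x).indicator (fun _ => (1 : ℝ)) y

/-- The joint distribution function `F(x) = P(Y ≤ x)` of a random vector `Y`,
for `x ∈ [-∞, ∞]ᵖ`. -/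
noncomputable def jointCDF {Ω : Type*} [MeasurableSpace Ω] {p : ℕ} (μ : Measure Ω)
    (Y : Ω → Fin p → ℝ) (x : Fin p → EReal) : ℝ :=
  μ.real {ω | Y ω ∈ lowerOrthant x}

/-- The Hermite coefficient `J_q(x) = E[(1_{G(ξ) ≤ x} - F(x)) H_q(ξ)]`, where `F` is the
distribution function of `G(ξ)`. -/
noncomputable def hermiteCoeff {Ω : Type*} [MeasurableSpace Ω] {p : ℕ} (μ : Measure Ω)
    (ξ : Ω → ℝ) (G : ℝ → Fin p → ℝ) (q : ℕ) (x : Fin p → EReal) : ℝ :=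
  ∫ ω, (indLE x (G (ξ ω)) - jointCDF μ (fun ω' => G (ξ ω')) x) * hermiteEval q (ξ ω) ∂μ

/-- The Hermite rank `m(x)` of `1_{G(·) ≤ x} - F(x)`: the index of the first nonzero Hermite
coefficient (`⊤` if all of them vanish). -/
noncomputable def hermiteRank {Ω : Type*} [MeasurableSpace Ω] {p : ℕ} (μ : Measure Ω)
    (ξ : Ω → ℝ) (G : ℝ → Fin p → ℝ) (x : Fin p → EReal) : ℕ∞ :=
  ⨅ (q : ℕ) (_ : hermiteCoeff μ ξ G q x ≠ 0), (q : ℕ∞)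

/-- The normalization `d_N`, with `d_N² = Var (∑_{j ≤ N} H_m(X_j))`. The sequence is indexed from
`0`, so that `X 0, …, X (N - 1)` are its first `N` terms. -/
noncomputable def normalization {Ω : Type*} [MeasurableSpace Ω] (μ : Measure Ω)
    (X : ℕ → Ω → ℝ) (m N : ℕ) : ℝ :=
  Real.sqrt (Var[fun ω => ∑ j ∈ Finset.range N, hermiteEval m (X j ω); μ])

/-- The reduced sum over the first `n` observations `Y_j = G(X_j)`,
`∑_{j ≤ n} (1_{Y_j ≤ x} - F(x) - (J_m(x) / m!) H_m(X_j))`. -/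
noncomputable def reducedSum {Ω : Type*} [MeasurableSpace Ω] {p : ℕ} (μ : Measure Ω)
    (X : ℕ → Ω → ℝ) (G : ℝ → Fin p → ℝ) (m n : ℕ) (x : Fin p → EReal) (ω : Ω) : ℝ :=
  ∑ j ∈ Finset.range n,
    (indLE x (G (X j ω)) - jointCDF μ (fun ω' => G (X 0 ω')) x
      - hermiteCoeff μ (X 0) G m x / (m ! : ℝ) * hermiteEval m (X j ω))

/-! Subtracting `F(x)` and the `m`-th Hermite term from the indicator of an orthant leaves exactly
the part of its Hermite expansion of order above `m`, because the coefficients of order `1, …, m -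
1` vanish (`reducedSum_eq`). For a function `g` of rank at least `m + 1`, Mehler's formula and
Parseval bound the second moment of `∑_{j ∈ I} g(X_j)` by `∑_{i,j ∈ I} |r(i - j)|^(m+1)` times
`‖g‖²` (`integral_sq_sum_le_of_hermite_rank`). Over `N` times the double sum is `O(N^(2-a))` for
every `a < min(1, (m+1)D)`, whereas `d_N²` is at least of order `N^(2-b)` for every `b` in `(mD,
1)`. Since `mD < min(1, (m+1)D)`, one can take `b < a`, and this gap is the source of the power of
`N`.

Uniformity in `n` and `x` costs only logarithms. The line is cut, coordinate by coordinate of `G`,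
into about `N²` ordered cells. The number of times and the `p` cell bounds are all written in
binary, so that a partial sum over a box of cells becomes a sum of `K^(p+1)` dyadic block sums with
`K = O(log N)`. Cauchy-Schwarz then bounds its square by one random variable that does not depend on
`n` or on the box. Its mean stays small because the squared norm of a remainder is at most the
probability of its box, and the boxes of one level are disjoint
(`sq_sum_hermiteRemainder_lowerBox_le`, `integral_maximalBound_le`).

An arbitrary orthant lies between two such boxes whose difference has probability at most `p / N²`.
As indicators are monotone in the set, only the low-order Hermite projections have to be compared,
and these change by at most a small multiple of a fixed square-integrable envelope
(`sq_sum_hermiteRemainder_le_of_between`). Markov's inequality for the resulting dominating variable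
(`exists_dominating_integrable`) concludes. -/

/-! ### Hermite polynomials and the standard Gaussian measure -/

/-- The `n`-th Hermite polynomial with real coefficients. -/
noncomputable def realHermite (n : ℕ) : Polynomial ℝ :=
  (Polynomial.hermite n).map (Int.castRingHom ℝ)

theorem hermiteEval_eq_eval (n : ℕ) (y : ℝ) : hermiteEval n y = (realHermite n).eval y := by
  rw [hermiteEval, realHermite, Polynomial.eval_map, Polynomial.aeval_def]
  rfl

/-- The Appell property; it turns the defining recursion, which contains a derivative, into the
three-term recurrence. -/
theorem derivative_hermite_succ (n : ℕ) :
    Polynomial.derivative (Polynomial.hermite (n + 1)) =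
      ((n : Polynomial ℤ) + 1) * Polynomial.hermite n := by
  induction n with
  | zero => simp [Polynomial.hermite_succ]
  | succ n ih =>
    rw [Polynomial.hermite_succ (n + 1), map_sub, Polynomial.derivative_mul, ih,
      Polynomial.derivative_mul]
    rw [Polynomial.hermite_succ n]
    simp
    ring

theorem realHermite_zero : realHermite 0 = 1 := by simp [realHermite]

theorem realHermite_one : realHermite 1 = Polynomial.X := by
  simp [realHermite]

theorem realHermite_succ (n : ℕ) :
    realHermite (n + 1) =
      Polynomial.X * realHermite n - Polynomial.derivative (realHermite n) := by
  simp [realHermite, Polynomial.hermite_succ, Polynomial.derivative_map]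

theorem derivative_realHermite_succ (n : ℕ) :
    Polynomial.derivative (realHermite (n + 1)) =
      Polynomial.C ((n : ℝ) + 1) * realHermite n := by
  rw [realHermite, Polynomial.derivative_map, derivative_hermite_succ]
  simp [realHermite]

theorem realHermite_succ_succ (n : ℕ) :
    realHermite (n + 2) =
      Polynomial.X * realHermite (n + 1) - Polynomial.C ((n : ℝ) + 1) * realHermite n := by
  rw [realHermite_succ (n + 1), derivative_realHermite_succ]

theorem hermiteEval_zero (y : ℝ) : hermiteEval 0 y = 1 := by
  simp [hermiteEval_eq_eval, realHermite_zero]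

theorem hermiteEval_one (y : ℝ) : hermiteEval 1 y = y := by
  simp [hermiteEval_eq_eval, realHermite_one]

theorem hermiteEval_succ_succ (n : ℕ) (y : ℝ) :
    hermiteEval (n + 2) y = y * hermiteEval (n + 1) y - ((n : ℝ) + 1) * hermiteEval n y := by
  simp [hermiteEval_eq_eval, realHermite_succ_succ]

theorem measurable_hermiteEval (n : ℕ) : Measurable (hermiteEval n) := by
  have : hermiteEval n = fun y => (realHermite n).eval y := funext (hermiteEval_eq_eval n)
  rw [this]
  exact (realHermite n).continuous.measurable

/-- The standard Gaussian measure on the line. -/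
noncomputable abbrev stdGaussian1 : Measure ℝ := gaussianReal 0 1

/-- One factor at a time is split off by Hölder with exponents `2p, 2p, p`; hence the induction runs
over all `p` at once. -/
theorem memLp_pow_stdGaussian (n : ℕ) (p : ENNReal) (hp : p ≠ ⊤) :
    MemLp (fun x : ℝ => x ^ n) p stdGaussian1 := by
  have h : (n : ENNReal) * p ≠ ⊤ := ENNReal.mul_ne_top (by simp) hp
  rcases Nat.eq_zero_or_pos n with rfl | hn
  · simpa using memLp_const (1 : ℝ)
  have := (memLp_id_gaussianReal' (μ := 0) (v := 1) ((n : ENNReal) * p) h)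
  induction n generalizing p with
  | zero => simpa using memLp_const (1 : ℝ)
  | succ k ih =>
    rcases Nat.eq_zero_or_pos k with rfl | hk
    · simpa [Function.id_def] using this
    have h2 : (2 * p) ≠ ⊤ := ENNReal.mul_ne_top (by simp) hp
    have h1 := ih (2 * p) h2 (ENNReal.mul_ne_top (by simp) h2) hk
      (memLp_id_gaussianReal' _ (ENNReal.mul_ne_top (by simp) h2))
    have h3 := (memLp_id_gaussianReal' (μ := 0) (v := 1) (2 * p) h2)
    have : ENNReal.HolderTriple (2 * p) (2 * p) p := ⟨by
      rw [ENNReal.mul_inv (by simp) (by simp), ← add_mul, ENNReal.inv_two_add_inv_two, one_mul]⟩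
    simpa [pow_succ', Pi.mul_def] using MemLp.mul (r := p) h1 h3

theorem memLp_polynomial_stdGaussian (q : Polynomial ℝ) (p : ENNReal) (hp : p ≠ ⊤) :
    MemLp (fun x : ℝ => q.eval x) p stdGaussian1 := by
  induction q using Polynomial.induction_on' with
  | add q r hq hr => simpa [Pi.add_def] using hq.add hr
  | monomial n a => simpa using (memLp_pow_stdGaussian n p hp).const_mul a

theorem integrable_polynomial_stdGaussian (q : Polynomial ℝ) :
    Integrable (fun x : ℝ => q.eval x) stdGaussian1 :=
  memLp_one_iff_integrable.1 (memLp_polynomial_stdGaussian q 1 (by simp))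

theorem memLp_hermiteEval (n : ℕ) (p : ENNReal) (hp : p ≠ ⊤) :
    MemLp (hermiteEval n) p stdGaussian1 := by
  have : hermiteEval n = fun y => (realHermite n).eval y := funext (hermiteEval_eq_eval n)
  rw [this]
  exact memLp_polynomial_stdGaussian _ p hp

/-- Stein's identity for polynomials. -/
theorem integral_mul_polynomial_stdGaussian (q : Polynomial ℝ) :
    ∫ x, x * q.eval x ∂stdGaussian1 = ∫ x, (Polynomial.derivative q).eval x ∂stdGaussian1 := by
  have hint (r : Polynomial ℝ) : Integrable (fun x : ℝ => gaussianPDFReal 0 1 x * r.eval x) := by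
    have h := integrable_polynomial_stdGaussian r
    rw [stdGaussian1, gaussianReal_of_var_ne_zero 0 one_ne_zero,
      integrable_withDensity_iff_integrable_smul' (measurable_gaussianPDF 0 1)
        (Eventually.of_forall fun x => gaussianPDF_lt_top)] at h
    simpa [toReal_gaussianPDF] using h
  have hphi (x : ℝ) : HasDerivAt (gaussianPDFReal 0 1) (-x * gaussianPDFReal 0 1 x) x := by
    have h1 : HasDerivAt (fun x : ℝ => -(x ^ 2) / 2) (-x) x := by
      have := ((hasDerivAt_pow 2 x).neg).div_const 2
      convert! this using 1
      push_cast
      ring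
    have h2 := (h1.exp).const_mul ((Real.sqrt (2 * Real.pi))⁻¹)
    have h3 : gaussianPDFReal 0 1 =
        fun x => (Real.sqrt (2 * Real.pi))⁻¹ * Real.exp (-(x ^ 2) / 2) := by
      ext y; simp [gaussianPDFReal]
    rw [h3]
    convert! h2 using 1
    ring
  have key : ∫ x, (-x * gaussianPDFReal 0 1 x * q.eval x +
      gaussianPDFReal 0 1 x * (Polynomial.derivative q).eval x) = 0 := by
    refine integral_eq_zero_of_hasDerivAt_of_integrable
      (f := fun x => gaussianPDFReal 0 1 x * q.eval x)
      (fun x => (hphi x).mul (q.hasDerivAt x)) ?_ (hint q)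
    have h1 := (hint (Polynomial.X * q)).neg
    have h2 := hint (Polynomial.derivative q)
    convert! h1.add h2 using 2 with x
    simp
    ring
  have h1 := hint (Polynomial.X * q)
  have h2 := hint (Polynomial.derivative q)
  rw [integral_gaussianReal_eq_integral_smul one_ne_zero,
    integral_gaussianReal_eq_integral_smul one_ne_zero]
  have h3 : ∫ x, (gaussianPDFReal 0 1 x * (Polynomial.derivative q).eval x -
      gaussianPDFReal 0 1 x * (Polynomial.X * q).eval x) = 0 := by
    refine Eq.trans (integral_congr_ae (Eventually.of_forall fun x => ?_)) key
    simp only [Polynomial.eval_mul, Polynomial.eval_X]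
    ring
  rw [integral_sub h2 h1] at h3
  simp only [smul_eq_mul]
  simp only [Polynomial.eval_mul, Polynomial.eval_X] at h3
  linarith

/-- Integration by parts: in the Gaussian `L²` space the raising operator `x - d/dx` is adjoint to
`d/dx`. -/
theorem integral_realHermite_succ_mul (n : ℕ) (q : Polynomial ℝ) :
    ∫ x, (realHermite (n + 1) * q).eval x ∂stdGaussian1 =
      ∫ x, (realHermite n * Polynomial.derivative q).eval x ∂stdGaussian1 := by
  have h := integral_mul_polynomial_stdGaussian (realHermite n * q)
  have e : realHermite (n + 1) * q = Polynomial.X * (realHermite n * q) -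
      Polynomial.derivative (realHermite n) * q := by
    rw [realHermite_succ]; ring
  have e2 : realHermite n * Polynomial.derivative q = Polynomial.derivative (realHermite n * q) -
      Polynomial.derivative (realHermite n) * q := by
    rw [Polynomial.derivative_mul]; ring
  have e3 : ∫ x, (Polynomial.X * (realHermite n * q)).eval x ∂stdGaussian1 =
      ∫ x, (Polynomial.derivative (realHermite n * q)).eval x ∂stdGaussian1 := by
    rw [← h]; simp
  rw [e, e2]
  simp only [Polynomial.eval_sub]
  rw [integral_sub (integrable_polynomial_stdGaussian _) (integrable_polynomial_stdGaussian _),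
    integral_sub (integrable_polynomial_stdGaussian _) (integrable_polynomial_stdGaussian _), e3]

/-- Each use of adjointness lowers both indices by one and produces the factor `k + 1`, until one of
the polynomials is constant. -/
theorem integral_hermiteEval_mul_hermiteEval (n k : ℕ) :
    ∫ x, hermiteEval n x * hermiteEval k x ∂stdGaussian1 = if n = k then (n ! : ℝ) else 0 := by
  suffices ∀ n k, ∫ x, (realHermite n * realHermite k).eval x ∂stdGaussian1 =
      if n = k then (n ! : ℝ) else 0 by
    simpa [hermiteEval_eq_eval] using this n k
  intro n
  induction n with
  | zero =>
    intro k
    cases k with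
    | zero => simp [realHermite_zero]
    | succ k =>
      rw [mul_comm, integral_realHermite_succ_mul]
      simp [realHermite_zero]
  | succ n ih =>
    intro k
    rw [integral_realHermite_succ_mul]
    cases k with
    | zero => simp [realHermite_zero]
    | succ k =>
      have h := ih k
      rw [derivative_realHermite_succ]
      simp only [Polynomial.eval_mul, Polynomial.eval_C] at h ⊢
      simp_rw [mul_left_comm _ ((k : ℝ) + 1) _]
      rw [integral_const_mul, h]
      by_cases hnk : n = k
      · subst hnk; simp [Nat.factorial_succ]
      · simp [hnk]

theorem integral_hermiteEval (n : ℕ) (hn : n ≠ 0) : ∫ x, hermiteEval n x ∂stdGaussian1 = 0 := by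
  have := integral_hermiteEval_mul_hermiteEval n 0
  simpa [hermiteEval_zero, hn] using this

/-- The Hermite polynomials diagonalize the Ornstein-Uhlenbeck operator. -/
theorem integral_hermiteEval_rotation (n : ℕ) (r s : ℝ) (hrs : r ^ 2 + s ^ 2 = 1) (x : ℝ) :
    ∫ z, hermiteEval n (r * x + s * z) ∂stdGaussian1 = r ^ n * hermiteEval n x := by
  have hcomp (n : ℕ) (z : ℝ) : hermiteEval n (r * x + s * z) =
      ((realHermite n).comp (Polynomial.C (r * x) + Polynomial.C s * Polynomial.X)).eval z := by
    simp [hermiteEval_eq_eval]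
  have hint (n : ℕ) : Integrable (fun z => hermiteEval n (r * x + s * z)) stdGaussian1 := by
    simp_rw [hcomp]
    exact integrable_polynomial_stdGaussian _
  induction n using Nat.twoStepInduction with
  | zero => simp [hermiteEval_zero]
  | one =>
    simp_rw [hermiteEval_one]
    rw [integral_add (integrable_const _) ?_, integral_const_mul]
    · rw [integral_const_mul s, integral_id_gaussianReal]; simp
    · simpa using (integrable_polynomial_stdGaussian Polynomial.X).const_mul s
  | more n ih0 ih1 =>
    -- Stein's identity in `z` contributes `s² (n + 1)`; the recurrence subtracts `n + 1`, and `s² -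
    -- 1 = -r²` restores the power `r^(n+2)`.
    have stein : ∫ z, z * hermiteEval (n + 1) (r * x + s * z) ∂stdGaussian1 =
        s * ((n : ℝ) + 1) * (r ^ n * hermiteEval n x) := by
      simp_rw [hcomp (n + 1)]
      rw [integral_mul_polynomial_stdGaussian, ← ih0, ← integral_const_mul]
      congr 1; ext z
      rw [hcomp n, Polynomial.derivative_comp, derivative_realHermite_succ]
      simp
      ring
    have hint2 : Integrable (fun z => z * hermiteEval (n + 1) (r * x + s * z)) stdGaussian1 := by
      have : (fun z => z * hermiteEval (n + 1) (r * x + s * z)) = fun z => (Polynomial.X *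
        (realHermite (n + 1)).comp
          (Polynomial.C (r * x) + Polynomial.C s * Polynomial.X)).eval z := by
        ext z; rw [hcomp]; simp
      rw [this]
      exact integrable_polynomial_stdGaussian _
    have e : ∀ z, hermiteEval (n + 2) (r * x + s * z) =
        (r * x * hermiteEval (n + 1) (r * x + s * z) +
          s * (z * hermiteEval (n + 1) (r * x + s * z))) -
            ((n : ℝ) + 1) * hermiteEval n (r * x + s * z) := by
      intro z; rw [hermiteEval_succ_succ]; ring
    simp_rw [e]
    rw [integral_sub (((hint _).const_mul _).fun_add (hint2.const_mul _)) ((hint n).const_mul _),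
      integral_add ((hint _).const_mul _) (hint2.const_mul _), integral_const_mul,
      integral_const_mul, integral_const_mul, ih0, ih1, stein, hermiteEval_succ_succ]
    linear_combination ((n : ℝ) + 1) * r ^ n * hermiteEval n x * hrs

/-! ### Completeness of the Hermite polynomials -/

/-- A finite measure on the line with all exponential moments is determined by its moments. -/
theorem measure_ext_of_moments (μ ν : Measure ℝ) [IsFiniteMeasure μ] [IsFiniteMeasure ν]
    (hμ : ∀ t : ℝ, Integrable (fun x : ℝ => Real.exp (t * x)) μ)
    (hν : ∀ t : ℝ, Integrable (fun x : ℝ => Real.exp (t * x)) ν)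
    (h : ∀ n : ℕ, ∫ x, x ^ n ∂μ = ∫ x, x ^ n ∂ν) : μ = ν := by
  have hset (ρ : Measure ℝ) (hρ : ∀ t : ℝ, Integrable (fun x : ℝ => Real.exp (t * x)) ρ) :
      integrableExpSet id ρ = Set.univ := by
    ext t; simpa [integrableExpSet] using hρ t
  -- With all exponential moments finite the complex moment generating function is entire, so it is
  -- its Taylor series at `0`, whose coefficients are the moments.
  have htaylor (ρ : Measure ℝ) (hρ : ∀ t : ℝ, Integrable (fun x : ℝ => Real.exp (t * x)) ρ)
      (z : ℂ) : ∑' n : ℕ, ((n ! : ℂ))⁻¹ • (z - 0) ^ n • (((∫ x, x ^ n ∂ρ : ℝ)) : ℂ) =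
        complexMGF id ρ z := by
    have hd : Differentiable ℂ (complexMGF id ρ) := by
      rw [← differentiableOn_univ]
      have := differentiableOn_complexMGF (X := id) (μ := ρ)
      rw [hset ρ hρ] at this
      simpa using this
    rw [← Complex.taylorSeries_eq_of_entire hd 0 z]
    congr 1; ext n
    rw [iteratedDeriv_complexMGF (by simp [hset ρ hρ])]
    simp [← integral_complex_ofReal]
  refine Measure.ext_of_complexMGF_id_eq ?_
  ext z
  rw [← htaylor μ hμ, ← htaylor ν hν]
  simp_rw [h]

theorem memLp_exp_mul_stdGaussian (t : ℝ) :
    MemLp (fun x : ℝ => Real.exp (t * x)) 2 stdGaussian1 := by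
  rw [memLp_two_iff_integrable_sq (by fun_prop)]
  have := integrable_exp_mul_gaussianReal (μ := 0) (v := 1) (2 * t)
  convert! this using 2 with x
  rw [← Real.exp_nat_mul]
  congr 1; push_cast; ring

/-- The positive and negative parts of `f`, taken as densities, give two finite measures with equal
moments. These measures coincide, which forces both parts to vanish. -/
theorem ae_eq_zero_of_forall_moment_eq_zero (f : ℝ → ℝ) (hf : MemLp f 2 stdGaussian1)
    (h : ∀ n : ℕ, ∫ x, f x * x ^ n ∂stdGaussian1 = 0) : f =ᵐ[stdGaussian1] 0 := by
  wlog hfm : Measurable f generalizing f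
  · have hae := hf.aestronglyMeasurable.aemeasurable
    have h1 := this (hae.mk f) ((memLp_congr_ae hae.ae_eq_mk).1 hf) (fun n => by
      rw [← h n]
      refine integral_congr_ae ?_
      filter_upwards [hae.ae_eq_mk] with x hx
      rw [hx]) hae.measurable_mk
    exact hae.ae_eq_mk.trans h1
  have hf1 : Integrable f stdGaussian1 := hf.integrable (by norm_num)
  have hfin (g : ℝ → ℝ) (hg : Integrable g stdGaussian1) :
      IsFiniteMeasure (stdGaussian1.withDensity fun x => ENNReal.ofReal (g x)) :=
    isFiniteMeasure_withDensity_ofReal hg.2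
  have := hfin f hf1
  have := hfin (-f) hf1.neg
  have hint (g : ℝ → ℝ) (hg : MemLp g 2 stdGaussian1) (hgm : Measurable g) (u : ℝ → ℝ)
      (hu : MemLp u 2 stdGaussian1) :
      Integrable u (stdGaussian1.withDensity fun x => ENNReal.ofReal (g x)) := by
    rw [integrable_withDensity_iff_integrable_smul' (by fun_prop) (by simp)]
    have hpos : MemLp (fun x => max (g x) 0) 2 stdGaussian1 := hg.pos_part
    simpa [ENNReal.toReal_ofReal', Pi.mul_def] using MemLp.integrable_mul hpos hu
  have hval (g : ℝ → ℝ) (hgm : Measurable g) (u : ℝ → ℝ) :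
      ∫ x, u x ∂(stdGaussian1.withDensity fun x => ENNReal.ofReal (g x)) =
        ∫ x, max (g x) 0 * u x ∂stdGaussian1 := by
    rw [integral_withDensity_eq_integral_toReal_smul (by fun_prop) (by simp)]
    simp [ENNReal.toReal_ofReal']
  have hμν : (stdGaussian1.withDensity fun x => ENNReal.ofReal (f x)) =
      stdGaussian1.withDensity fun x => ENNReal.ofReal ((-f) x) := by
    refine measure_ext_of_moments _ _ (fun t => hint f hf hfm _ (memLp_exp_mul_stdGaussian t))
      (fun t => hint (-f) hf.neg hfm.neg _ (memLp_exp_mul_stdGaussian t)) (fun n => ?_)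
    rw [hval f hfm, hval (-f) hfm.neg, ← sub_eq_zero]
    have hp := memLp_pow_stdGaussian n 2 (by simp)
    have i1 : Integrable (fun x => max (f x) 0 * x ^ n) stdGaussian1 :=
      MemLp.integrable_mul hf.pos_part hp
    have i2 : Integrable (fun x => max ((-f) x) 0 * x ^ n) stdGaussian1 :=
      MemLp.integrable_mul hf.neg.pos_part hp
    rw [← integral_sub i1 i2]
    refine Eq.trans (integral_congr_ae (Eventually.of_forall fun x => ?_)) (h n)
    simp only []
    rw [← sub_mul]
    congr 1
    simp only [Pi.neg_apply]
    rcases le_total (f x) 0 with hx | hx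
    · rw [max_eq_right hx, max_eq_left (by linarith)]; ring
    · rw [max_eq_left hx, max_eq_right (by linarith)]; ring
  rw [withDensity_eq_iff_of_sigmaFinite (by fun_prop) (by fun_prop)] at hμν
  filter_upwards [hμν] with x hx
  simp only [Pi.neg_apply] at hx
  simp only [Pi.zero_apply]
  rcases lt_trichotomy (f x) 0 with h0 | h0 | h0
  · rw [ENNReal.ofReal_of_nonpos h0.le, eq_comm, ENNReal.ofReal_eq_zero] at hx
    linarith
  · exact h0
  · rw [ENNReal.ofReal_of_nonpos (p := -f x) (by linarith), ENNReal.ofReal_eq_zero] at hx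
    linarith

/-- Powers are traded for Hermite polynomials through `x H_{q+1} = H_{q+2} + (q+1) H_q`; the
induction on the power therefore treats `x^n H_q` for all `q` together. -/
theorem ae_eq_zero_of_forall_integral_hermiteEval (f : ℝ → ℝ) (hf : MemLp f 2 stdGaussian1)
    (h : ∀ n : ℕ, ∫ x, f x * hermiteEval n x ∂stdGaussian1 = 0) : f =ᵐ[stdGaussian1] 0 := by
  refine ae_eq_zero_of_forall_moment_eq_zero f hf fun n => ?_
  suffices ∀ n q : ℕ, ∫ x, f x * (x ^ n * hermiteEval q x) ∂stdGaussian1 = 0 by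
    simpa [hermiteEval_zero] using this n 0
  have hint (n q : ℕ) :
      Integrable (fun x => f x * (x ^ n * hermiteEval q x)) stdGaussian1 := by
    have := memLp_polynomial_stdGaussian (Polynomial.X ^ n * realHermite q) 2 (by simp)
    simp only [Polynomial.eval_mul, Polynomial.eval_pow, Polynomial.eval_X,
      ← hermiteEval_eq_eval] at this
    exact MemLp.integrable_mul hf this
  intro n
  induction n with
  | zero => intro q; simpa using h q
  | succ n ih =>
    intro q
    cases q with
    | zero =>
      rw [← ih 1]
      congr 1; ext x; rw [hermiteEval_zero, hermiteEval_one]; ring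
    | succ q =>
      have e : ∀ x, f x * (x ^ (n + 1) * hermiteEval (q + 1) x) =
          f x * (x ^ n * hermiteEval (q + 2) x) +
            ((q : ℝ) + 1) * (f x * (x ^ n * hermiteEval q x)) := by
        intro x; rw [hermiteEval_succ_succ]; ring
      simp_rw [e]
      rw [integral_add (hint _ _) ((hint _ _).const_mul _), integral_const_mul, ih, ih]
      simp

/-! ### Hermite expansions in `L²` of the standard Gaussian measure -/

/-- The partial sums of the Hermite expansion of a function. -/
noncomputable def hermitePartialSum (g : ℝ → ℝ) (Q : ℕ) (x : ℝ) : ℝ :=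
  ∑ q ∈ Finset.range Q, (∫ y, g y * hermiteEval q y ∂stdGaussian1) / (q ! : ℝ) * hermiteEval q x

theorem memLp_hermitePartialSum (g : ℝ → ℝ) (Q : ℕ) :
    MemLp (hermitePartialSum g Q) 2 stdGaussian1 :=
  memLp_finsetSum _ fun q _ => (memLp_hermiteEval q 2 (by simp)).const_mul _

theorem integral_hermitePartialSum_mul (g : ℝ → ℝ) (Q k : ℕ) :
    ∫ x, hermitePartialSum g Q x * hermiteEval k x ∂stdGaussian1 =
      if k < Q then ∫ y, g y * hermiteEval k y ∂stdGaussian1 else 0 := by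
  simp_rw [hermitePartialSum, Finset.sum_mul, mul_assoc]
  rw [integral_finsetSum]
  · simp_rw [integral_const_mul, integral_hermiteEval_mul_hermiteEval]
    by_cases hk : k < Q
    · rw [Finset.sum_eq_single k (fun b _ hb => by simp [hb]) (fun h => by simp_all)]
      have : (k ! : ℝ) ≠ 0 := by positivity
      simp [hk]
      field_simp
    · rw [if_neg hk]
      refine Finset.sum_eq_zero fun q hq => ?_
      have : q ≠ k := by rintro rfl; exact hk (Finset.mem_range.1 hq)
      simp [this]
  · intro q _
    exact (MemLp.integrable_mul (memLp_hermiteEval q 2 (by simp))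
      (memLp_hermiteEval k 2 (by simp))).const_mul _

theorem integral_sq_sub_hermitePartialSum (g : ℝ → ℝ) (hg : MemLp g 2 stdGaussian1) (Q : ℕ) :
    ∫ x, (g x - hermitePartialSum g Q x) ^ 2 ∂stdGaussian1 =
      ∫ x, g x ^ 2 ∂stdGaussian1 -
        ∑ q ∈ Finset.range Q, (∫ y, g y * hermiteEval q y ∂stdGaussian1) ^ 2 / (q ! : ℝ) := by
  induction Q with
  | zero => simp [hermitePartialSum]
  | succ Q ih =>
    set c := ∫ y, g y * hermiteEval Q y ∂stdGaussian1 with hc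
    have hd := hg.sub (memLp_hermitePartialSum g Q)
    have hH := memLp_hermiteEval Q 2 (by simp)
    have i1 : Integrable (fun x => (g x - hermitePartialSum g Q x) ^ 2) stdGaussian1 :=
      hd.integrable_sq
    have i2 : Integrable (fun x => (g x - hermitePartialSum g Q x) * hermiteEval Q x)
      stdGaussian1 := MemLp.integrable_mul hd hH
    have i3 : Integrable (fun x => hermiteEval Q x * hermiteEval Q x) stdGaussian1 :=
      MemLp.integrable_mul hH hH
    have e : ∀ x, (g x - hermitePartialSum g (Q + 1) x) ^ 2 =
        (g x - hermitePartialSum g Q x) ^ 2 +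
          (-2 * (c / (Q ! : ℝ)) * ((g x - hermitePartialSum g Q x) * hermiteEval Q x) +
            (c / (Q ! : ℝ)) ^ 2 * (hermiteEval Q x * hermiteEval Q x)) := by
      intro x
      rw [hermitePartialSum, Finset.sum_range_succ, ← hermitePartialSum, ← hc]
      ring
    have i4 : ∫ x, (g x - hermitePartialSum g Q x) * hermiteEval Q x ∂stdGaussian1 = c := by
      simp_rw [sub_mul]
      rw [integral_sub (f := fun x => g x * hermiteEval Q x)
        (g := fun x => hermitePartialSum g Q x * hermiteEval Q x) (MemLp.integrable_mul hg hH)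
        (MemLp.integrable_mul (memLp_hermitePartialSum g Q) hH), integral_hermitePartialSum_mul]
      simp [hc]
    simp_rw [e]
    rw [integral_add i1 ((i2.const_mul _).fun_add (i3.const_mul _)),
      integral_add (i2.const_mul _) (i3.const_mul _), integral_const_mul, integral_const_mul, i4,
      integral_hermiteEval_mul_hermiteEval, if_pos rfl, ih, Finset.sum_range_succ, ← hc]
    have : (Q ! : ℝ) ≠ 0 := by positivity
    field_simp
    ring

theorem inner_toLp_eq_integral (f g : ℝ → ℝ) (hf : MemLp f 2 stdGaussian1)
    (hg : MemLp g 2 stdGaussian1) :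
    inner ℝ (hf.toLp f) (hg.toLp g) = ∫ x, f x * g x ∂stdGaussian1 := by
  rw [L2.inner_def]
  refine integral_congr_ae ?_
  filter_upwards [hf.coeFn_toLp, hg.coeFn_toLp] with x h1 h2
  rw [h1, h2]
  simp [mul_comm]

/-- Parseval's identity for the Hermite expansion. -/
theorem hasSum_sq_hermiteCoeff (g : ℝ → ℝ) (hg : MemLp g 2 stdGaussian1) :
    HasSum (fun q : ℕ => (∫ y, g y * hermiteEval q y ∂stdGaussian1) ^ 2 / (q ! : ℝ))
      (∫ x, g x ^ 2 ∂stdGaussian1) := by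
  let u (q : ℕ) : ℝ → ℝ := fun x => (Real.sqrt (q ! : ℝ))⁻¹ * hermiteEval q x
  have hu (q : ℕ) : MemLp (u q) 2 stdGaussian1 :=
    (memLp_hermiteEval q 2 (by simp)).const_mul _
  have hsq (q : ℕ) : Real.sqrt (q ! : ℝ) * Real.sqrt (q ! : ℝ) = (q ! : ℝ) :=
    Real.mul_self_sqrt (by positivity)
  have hsq0 (q : ℕ) : Real.sqrt (q ! : ℝ) ≠ 0 := by positivity
  have hcancel (t F : ℝ) (h0 : t ≠ 0) (h : t * t = F) : t⁻¹ * (t⁻¹ * F) = 1 := by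
    subst h; field_simp
  have hinner (f : ℝ → ℝ) (hf : MemLp f 2 stdGaussian1) (q : ℕ) :
      inner ℝ (hf.toLp f) ((hu q).toLp (u q)) =
        (Real.sqrt (q ! : ℝ))⁻¹ * ∫ x, f x * hermiteEval q x ∂stdGaussian1 := by
    rw [inner_toLp_eq_integral, ← integral_const_mul]
    congr 1; ext x; simp only [u]; ring
  have hon : Orthonormal ℝ fun q => (hu q).toLp (u q) := by
    rw [orthonormal_iff_ite]
    intro i j
    rw [hinner]
    simp only [u, mul_assoc]
    rw [integral_const_mul, integral_hermiteEval_mul_hermiteEval]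
    by_cases hij : i = j
    · subst hij
      rw [if_pos rfl, if_pos rfl]
      linear_combination (hcancel _ _ (hsq0 i) (hsq i))
    · simp [hij]
  -- Completeness enters here and upgrades the normalized family to a Hilbert basis.
  have hbot : (Submodule.span ℝ (Set.range fun q => (hu q).toLp (u q)))ᗮ = ⊥ := by
    rw [Submodule.eq_bot_iff]
    intro f hf
    have hfm : MemLp f 2 stdGaussian1 := Lp.memLp f
    have h0 : (f : ℝ → ℝ) =ᵐ[stdGaussian1] 0 := by
      refine ae_eq_zero_of_forall_integral_hermiteEval f hfm fun q => ?_
      have h1 := hf ((hu q).toLp (u q)) (Submodule.subset_span ⟨q, rfl⟩)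
      rw [real_inner_comm, ← Lp.toLp_coeFn f hfm, hinner] at h1
      exact (mul_eq_zero.1 h1).resolve_left (inv_ne_zero (hsq0 q))
    exact (Lp.eq_zero_iff_ae_eq_zero).2 h0
  let b := HilbertBasis.mkOfOrthogonalEqBot hon hbot
  have h := b.hasSum_inner_mul_inner (hg.toLp g) (hg.toLp g)
  rw [inner_toLp_eq_integral] at h
  convert! h using 1
  · ext q
    have hb : b q = (hu q).toLp (u q) := by
      rw [HilbertBasis.coe_mkOfOrthogonalEqBot]
    rw [real_inner_comm (hg.toLp g) (b q), hb, hinner]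
    have hinv : ((q ! : ℝ))⁻¹ = (Real.sqrt (q ! : ℝ))⁻¹ * (Real.sqrt (q ! : ℝ))⁻¹ := by
      rw [← mul_inv, hsq]
    rw [div_eq_mul_inv, hinv]
    ring
  · simp_rw [sq]

theorem sum_sq_hermiteCoeff_le (g : ℝ → ℝ) (hg : MemLp g 2 stdGaussian1) (Q : ℕ) :
    ∑ q ∈ Finset.range Q, (∫ y, g y * hermiteEval q y ∂stdGaussian1) ^ 2 / (q ! : ℝ) ≤
      ∫ x, g x ^ 2 ∂stdGaussian1 :=
  sum_le_hasSum _ (fun q _ => by positivity) (hasSum_sq_hermiteCoeff g hg)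

theorem tendsto_integral_sq_sub_hermitePartialSum (g : ℝ → ℝ) (hg : MemLp g 2 stdGaussian1) :
    Tendsto (fun Q => ∫ x, (g x - hermitePartialSum g Q x) ^ 2 ∂stdGaussian1) atTop (𝓝 0) := by
  simp_rw [integral_sq_sub_hermitePartialSum g hg]
  have := (hasSum_sq_hermiteCoeff g hg).tendsto_sum_nat
  rw [← sub_self (∫ x, g x ^ 2 ∂stdGaussian1)]
  exact this.const_sub _

/-! ### Pairs of jointly Gaussian standard variables -/

section Pair

variable {Ω : Type*} [MeasurableSpace Ω] {μ : Measure Ω} {X Y : Ω → ℝ}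

theorem integral_comp_of_map_eq (hX : AEMeasurable X μ) (hmap : μ.map X = stdGaussian1)
    (f : ℝ → ℝ) (hf : AEStronglyMeasurable f stdGaussian1) :
    ∫ ω, f (X ω) ∂μ = ∫ x, f x ∂stdGaussian1 := by
  rw [← hmap, integral_map hX (by rwa [hmap])]

theorem memLp_comp_of_map_eq (hX : AEMeasurable X μ) (hmap : μ.map X = stdGaussian1)
    (f : ℝ → ℝ) (p : ENNReal) (hf : MemLp f p stdGaussian1) : MemLp (fun ω => f (X ω)) p μ := by
  rw [← hmap] at hf
  exact (memLp_map_measure_iff hf.1 hX).1 hf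

/-- Mehler's formula. The regression residual `W = Y - rX` is uncorrelated with `X`, hence
independent of it, and distributed as `sZ` with `r² + s² = 1` and `Z` standard normal. Integrating
`W` out replaces `H_k(Y)` by `r^k H_k(X)`, and orthogonality finishes. -/
theorem integral_hermiteEval_mul_of_gaussian_pair [IsProbabilityMeasure μ]
    (hXY : HasGaussianLaw (fun ω => (X ω, Y ω)) μ)
    (hX : μ.map X = stdGaussian1) (hY : μ.map Y = stdGaussian1) (n k : ℕ) :
    ∫ ω, hermiteEval n (X ω) * hermiteEval k (Y ω) ∂μ =
      if n = k then (n ! : ℝ) * (∫ ω, X ω * Y ω ∂μ) ^ n else 0 := by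
  have hXm := hXY.fst.aemeasurable
  have hYm := hXY.snd.aemeasurable
  have hHX (n : ℕ) := memLp_comp_of_map_eq hXm hX _ 2 (memLp_hermiteEval n 2 (by simp))
  have hHY (n : ℕ) := memLp_comp_of_map_eq hYm hY _ 2 (memLp_hermiteEval n 2 (by simp))
  have hX2 : MemLp X 2 μ := by simpa [hermiteEval_one] using hHX 1
  have hY2 : MemLp Y 2 μ := by simpa [hermiteEval_one] using hHY 1
  have hEX : ∫ ω, X ω ∂μ = 0 := by
    have := integral_comp_of_map_eq hXm hX _ (memLp_hermiteEval 1 2 (by simp)).1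
    rw [integral_hermiteEval 1 (by simp)] at this
    simpa [hermiteEval_one] using this
  have hEY : ∫ ω, Y ω ∂μ = 0 := by
    have := integral_comp_of_map_eq hYm hY _ (memLp_hermiteEval 1 2 (by simp)).1
    rw [integral_hermiteEval 1 (by simp)] at this
    simpa [hermiteEval_one] using this
  have hsq : ∫ x, x * x ∂stdGaussian1 = 1 := by
    simpa [hermiteEval_one] using integral_hermiteEval_mul_hermiteEval 1 1
  have hEXX : ∫ ω, X ω * X ω ∂μ = 1 := by
    rw [integral_comp_of_map_eq hXm hX (fun x => x * x) (by fun_prop), hsq]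
  have hEYY : ∫ ω, Y ω * Y ω ∂μ = 1 := by
    rw [integral_comp_of_map_eq hYm hY (fun x => x * x) (by fun_prop), hsq]
  set r := ∫ ω, X ω * Y ω ∂μ with hr
  let W : Ω → ℝ := fun ω => Y ω - r * X ω
  have hXW : HasGaussianLaw (fun ω => (X ω, W ω)) μ := by
    have := hXY.map_fun ((ContinuousLinearMap.fst ℝ ℝ ℝ).prod
      (ContinuousLinearMap.snd ℝ ℝ ℝ - r • ContinuousLinearMap.fst ℝ ℝ ℝ))
    simpa [W] using this
  have hW2 : MemLp W 2 μ := hY2.sub (hX2.const_mul r)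
  have hWm := hXW.snd.aemeasurable
  have iXX : Integrable (fun ω => X ω * X ω) μ := MemLp.integrable_mul hX2 hX2
  have iXY : Integrable (fun ω => X ω * Y ω) μ := MemLp.integrable_mul hX2 hY2
  have iYY : Integrable (fun ω => Y ω * Y ω) μ := MemLp.integrable_mul hY2 hY2
  have hEW : ∫ ω, W ω ∂μ = 0 := by
    simp only [W]
    rw [integral_sub (hY2.integrable (by norm_num)) ((hX2.integrable (by norm_num)).const_mul _),
      integral_const_mul, hEX, hEY]
    simp
  have hcov : cov[X, W; μ] = 0 := by
    rw [covariance_eq_sub hX2 hW2, hEW, mul_zero, sub_zero]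
    have : ∀ ω, (X * W) ω = X ω * Y ω - r * (X ω * X ω) := by
      intro ω; simp only [W, Pi.mul_apply]; ring
    simp_rw [this]
    rw [integral_sub iXY (iXX.const_mul _), integral_const_mul, hEXX, ← hr]
    ring
  have hindep : IndepFun X W μ := hXW.indepFun_of_covariance_eq_zero hcov
  have hvar : Var[W; μ] = 1 - r ^ 2 := by
    rw [variance_eq_sub hW2, hEW]
    have : ∀ ω, (W ^ 2) ω = (Y ω * Y ω - 2 * r * (X ω * Y ω)) + r ^ 2 * (X ω * X ω) := by
      intro ω; simp only [W, Pi.pow_apply]; ring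
    simp_rw [this]
    rw [integral_add (iYY.sub' (iXY.const_mul _)) (iXX.const_mul _),
      integral_sub iYY (iXY.const_mul _), integral_const_mul, integral_const_mul, hEXX, hEYY, ← hr]
    ring
  set s := Real.sqrt (1 - r ^ 2) with hs
  have hrs : r ^ 2 + s ^ 2 = 1 := by
    rw [hs, Real.sq_sqrt (hvar ▸ variance_nonneg W μ)]; ring
  have hWlaw : μ.map W = stdGaussian1.map fun z => s * z := by
    rw [hXW.snd.map_eq_gaussianReal, hEW, hvar, gaussianReal_map_const_mul]
    congr 1
    · simp
    · ext
      simp [hs, Real.sq_sqrt (hvar ▸ variance_nonneg W μ), (hvar ▸ variance_nonneg W μ : 0 ≤ 1 - r ^ 2)]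
  have hprod : μ.map (fun ω => (X ω, W ω)) = stdGaussian1.prod (μ.map W) := by
    rw [(indepFun_iff_map_prod_eq_prod_map_map hXm hWm).1 hindep, hX]
  have hmeas : Measurable fun p : ℝ × ℝ => hermiteEval n p.1 * hermiteEval k (r * p.1 + p.2) :=
    ((measurable_hermiteEval n).comp measurable_fst).mul
      ((measurable_hermiteEval k).comp (by fun_prop))
  have hfun : (fun ω => hermiteEval n (X ω) * hermiteEval k (Y ω)) =
      (fun p : ℝ × ℝ => hermiteEval n p.1 * hermiteEval k (r * p.1 + p.2)) ∘
        fun ω => (X ω, W ω) := by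
    ext ω; simp [W]
  have hint : Integrable (fun p : ℝ × ℝ => hermiteEval n p.1 * hermiteEval k (r * p.1 + p.2))
      (stdGaussian1.prod (μ.map W)) := by
    rw [← hprod, integrable_map_measure hmeas.aestronglyMeasurable hXW.aemeasurable, ← hfun]
    exact MemLp.integrable_mul (hHX n) (hHY k)
  have : IsProbabilityMeasure (μ.map W) := Measure.isProbabilityMeasure_map hWm
  calc ∫ ω, hermiteEval n (X ω) * hermiteEval k (Y ω) ∂μ
      = ∫ p : ℝ × ℝ, hermiteEval n p.1 * hermiteEval k (r * p.1 + p.2)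
          ∂(μ.map fun ω => (X ω, W ω)) := by
        rw [integral_map hXW.aemeasurable hmeas.aestronglyMeasurable]
        exact congrArg (fun f => ∫ ω, f ω ∂μ) hfun
    _ = ∫ x, r ^ k * (hermiteEval n x * hermiteEval k x) ∂stdGaussian1 := by
        rw [hprod, integral_prod _ hint]
        congr 1; ext x
        dsimp only
        rw [integral_const_mul, hWlaw, integral_map (by fun_prop)
          (by exact ((measurable_hermiteEval k).comp (by fun_prop)).aestronglyMeasurable),
          integral_hermiteEval_rotation k r s hrs]
        ring
    _ = _ := by
        rw [integral_const_mul, integral_hermiteEval_mul_hermiteEval]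
        by_cases hnk : n = k
        · subst hnk; simp [mul_comm]
        · simp [hnk]

theorem abs_integral_mul_le_one
    (hXm : AEMeasurable X μ) (hYm : AEMeasurable Y μ)
    (hX : μ.map X = stdGaussian1) (hY : μ.map Y = stdGaussian1) :
    |∫ ω, X ω * Y ω ∂μ| ≤ 1 := by
  have hid : MemLp (fun x : ℝ => x) 2 stdGaussian1 := by
    simpa using memLp_pow_stdGaussian 1 2 (by simp)
  have hsq : ∫ x, x ^ 2 ∂stdGaussian1 = 1 := by
    simpa [hermiteEval_one, sq] using integral_hermiteEval_mul_hermiteEval 1 1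
  have hX2 := (memLp_comp_of_map_eq hXm hX _ 2 hid).integrable_sq
  have hY2 := (memLp_comp_of_map_eq hYm hY _ 2 hid).integrable_sq
  have hXX : ∫ ω, X ω ^ 2 ∂μ = 1 := by
    rw [integral_comp_of_map_eq hXm hX (fun x => x ^ 2) (by fun_prop), hsq]
  have hYY : ∫ ω, Y ω ^ 2 ∂μ = 1 := by
    rw [integral_comp_of_map_eq hYm hY (fun x => x ^ 2) (by fun_prop), hsq]
  calc |∫ ω, X ω * Y ω ∂μ| ≤ ∫ ω, |X ω * Y ω| ∂μ := abs_integral_le_integral_abs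
    _ ≤ ∫ ω, (X ω ^ 2 + Y ω ^ 2) / 2 ∂μ := by
        refine integral_mono_of_nonneg (Eventually.of_forall fun ω => abs_nonneg _)
          ((hX2.add hY2).div_const 2) (Eventually.of_forall fun ω => ?_)
        simp only [abs_mul]
        rw [← sq_abs (X ω), ← sq_abs (Y ω)]
        nlinarith [sq_nonneg (|X ω| - |Y ω|)]
    _ = 1 := by
        rw [integral_div, integral_add hX2 hY2, hXX, hYY]; norm_num

end Pair

/-! ### Second moments of sums of functions of a Gaussian sequence -/

section Sequence

variable {Ω ι : Type*} [MeasurableSpace Ω] {μ : Measure Ω} [IsProbabilityMeasure μ]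
  {X : ι → Ω → ℝ}

/-- By Mehler's formula each covariance is a series in powers `r^q` with coefficients `c_q² / q!`,
where only `q ≥ k` occurs. As `|r| ≤ 1`, a factor `|r|^k` can be pulled out, and Bessel's inequality
bounds the rest. -/
theorem integral_sq_sum_hermitePartialSum_le
    (hpair : ∀ i j, HasGaussianLaw (fun ω => (X i ω, X j ω)) μ)
    (hmap : ∀ i, μ.map (X i) = stdGaussian1) (I : Finset ι) (g : ℝ → ℝ)
    (hg : MemLp g 2 stdGaussian1) (k : ℕ)
    (hg0 : ∀ q < k, ∫ x, g x * hermiteEval q x ∂stdGaussian1 = 0) (Q : ℕ) :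
    ∫ ω, (∑ j ∈ I, hermitePartialSum g Q (X j ω)) ^ 2 ∂μ ≤
      (∑ i ∈ I, ∑ j ∈ I, |∫ ω, X i ω * X j ω ∂μ| ^ k) * ∫ x, g x ^ 2 ∂stdGaussian1 := by
  have hXm (i : ι) : AEMeasurable (X i) μ := (hpair i i).fst.aemeasurable
  have hH (q : ℕ) (j : ι) := memLp_comp_of_map_eq (hXm j) (hmap j) _ 2
    (memLp_hermiteEval q 2 (by simp))
  set c : ℕ → ℝ := fun q => ∫ y, g y * hermiteEval q y ∂stdGaussian1 with hc
  have hS (j : ι) := memLp_comp_of_map_eq (hXm j) (hmap j) _ 2 (memLp_hermitePartialSum g Q)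
  have hij (i j : ι) : ∫ ω, hermitePartialSum g Q (X i ω) * hermitePartialSum g Q (X j ω) ∂μ =
      ∑ q ∈ Finset.range Q, c q ^ 2 / (q ! : ℝ) * (∫ ω, X i ω * X j ω ∂μ) ^ q := by
    have hi (q r : ℕ) : Integrable (fun ω => hermiteEval q (X i ω) * hermiteEval r (X j ω)) μ :=
      MemLp.integrable_mul (hH q i) (hH r j)
    have e : ∀ ω, hermitePartialSum g Q (X i ω) * hermitePartialSum g Q (X j ω) =
        ∑ q ∈ Finset.range Q, ∑ r ∈ Finset.range Q, (c q / (q ! : ℝ) * (c r / (r ! : ℝ))) *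
          (hermiteEval q (X i ω) * hermiteEval r (X j ω)) := by
      intro ω
      rw [hermitePartialSum, hermitePartialSum, Finset.sum_mul_sum]
      refine Finset.sum_congr rfl fun q _ => Finset.sum_congr rfl fun r _ => ?_
      ring
    simp_rw [e]
    rw [integral_finsetSum _ fun q _ => integrable_finsetSum _ fun r _ => (hi q r).const_mul _]
    refine Finset.sum_congr rfl fun q hq => ?_
    rw [integral_finsetSum _ fun r _ => (hi q r).const_mul _]
    simp_rw [integral_const_mul,
      integral_hermiteEval_mul_of_gaussian_pair (hpair i j) (hmap i) (hmap j)]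
    rw [Finset.sum_eq_single q (fun b _ hb => by simp [hb.symm]) (fun h => (h hq).elim)]
    have : (q ! : ℝ) ≠ 0 := by positivity
    simp
    field_simp
  simp_rw [sq (∑ j ∈ I, _), Finset.sum_mul_sum]
  have hint (i j : ι) : Integrable
      (fun ω => hermitePartialSum g Q (X i ω) * hermitePartialSum g Q (X j ω)) μ :=
    MemLp.integrable_mul (hS i) (hS j)
  rw [integral_finsetSum _ fun i _ => integrable_finsetSum _ fun j _ => hint i j, Finset.sum_mul]
  refine Finset.sum_le_sum fun i _ => ?_
  rw [integral_finsetSum _ fun j _ => hint i j, Finset.sum_mul]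
  refine Finset.sum_le_sum fun j _ => ?_
  rw [hij]
  set r := ∫ ω, X i ω * X j ω ∂μ
  have hr : |r| ≤ 1 := abs_integral_mul_le_one (hXm i) (hXm j) (hmap i) (hmap j)
  calc ∑ q ∈ Finset.range Q, c q ^ 2 / (q ! : ℝ) * r ^ q
      ≤ ∑ q ∈ Finset.range Q, |r| ^ k * (c q ^ 2 / (q ! : ℝ)) := by
        refine Finset.sum_le_sum fun q _ => ?_
        rcases lt_or_ge q k with hq | hq
        · have : c q = 0 := hg0 q hq
          simp [this]
        · rw [mul_comm]
          refine mul_le_mul_of_nonneg_right ?_ (by positivity)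
          calc r ^ q ≤ |r ^ q| := le_abs_self _
            _ = |r| ^ q := abs_pow _ _
            _ ≤ |r| ^ k := pow_le_pow_of_le_one (abs_nonneg _) hr hq
    _ = |r| ^ k * ∑ q ∈ Finset.range Q, c q ^ 2 / (q ! : ℝ) := by rw [Finset.mul_sum]
    _ ≤ _ := mul_le_mul_of_nonneg_left (sum_sq_hermiteCoeff_le g hg Q) (by positivity)

/-- Covariance inequality for functions of Hermite rank at least `k`. -/
theorem integral_sq_sum_le_of_hermite_rank
    (hpair : ∀ i j, HasGaussianLaw (fun ω => (X i ω, X j ω)) μ)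
    (hmap : ∀ i, μ.map (X i) = stdGaussian1) (I : Finset ι) (g : ℝ → ℝ)
    (hg : MemLp g 2 stdGaussian1) (k : ℕ)
    (hg0 : ∀ q < k, ∫ x, g x * hermiteEval q x ∂stdGaussian1 = 0) :
    ∫ ω, (∑ j ∈ I, g (X j ω)) ^ 2 ∂μ ≤
      (∑ i ∈ I, ∑ j ∈ I, |∫ ω, X i ω * X j ω ∂μ| ^ k) * ∫ x, g x ^ 2 ∂stdGaussian1 := by
  have hXm (i : ι) : AEMeasurable (X i) μ := (hpair i i).fst.aemeasurable
  set R := (∑ i ∈ I, ∑ j ∈ I, |∫ ω, X i ω * X j ω ∂μ| ^ k) * ∫ x, g x ^ 2 ∂stdGaussian1 with hR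
  have hS (Q : ℕ) (j : ι) := memLp_comp_of_map_eq (hXm j) (hmap j) _ 2
    (memLp_hermitePartialSum g Q)
  have hdg (Q : ℕ) := hg.sub (memLp_hermitePartialSum g Q)
  have hd (Q : ℕ) (j : ι) := memLp_comp_of_map_eq (hXm j) (hmap j) _ 2 (hdg Q)
  have hgX (j : ι) := memLp_comp_of_map_eq (hXm j) (hmap j) _ 2 hg
  -- Weighted Young inequality for truncation plus tail. Letting `Q → ∞` removes the tail for fixed
  -- `η`; then `η → 0` restores the sharp constant.
  have key (η : ℝ) (hη : 0 < η) (Q : ℕ) : ∫ ω, (∑ j ∈ I, g (X j ω)) ^ 2 ∂μ ≤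
      (1 + η) * R + (1 + η⁻¹) * ((I.card : ℝ) * (I.card *
        ∫ x, (g x - hermitePartialSum g Q x) ^ 2 ∂stdGaussian1)) := by
    have i1 : Integrable (fun ω => (∑ j ∈ I, hermitePartialSum g Q (X j ω)) ^ 2) μ :=
      (memLp_finsetSum I fun j _ => hS Q j).integrable_sq
    have i2 (j : ι) : Integrable (fun ω => (g (X j ω) - hermitePartialSum g Q (X j ω)) ^ 2) μ :=
      (hd Q j).integrable_sq
    have i3 : Integrable (fun ω => ∑ j ∈ I, (g (X j ω) - hermitePartialSum g Q (X j ω)) ^ 2) μ :=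
      integrable_finsetSum _ fun j _ => i2 j
    have h3 : ∫ ω, ∑ j ∈ I, (g (X j ω) - hermitePartialSum g Q (X j ω)) ^ 2 ∂μ =
        I.card * ∫ x, (g x - hermitePartialSum g Q x) ^ 2 ∂stdGaussian1 := by
      rw [integral_finsetSum _ fun j _ => i2 j, ← nsmul_eq_mul, ← Finset.sum_const]
      refine Finset.sum_congr rfl fun j _ => ?_
      exact integral_comp_of_map_eq (hXm j) (hmap j)
        (fun x => (g x - hermitePartialSum g Q x) ^ 2) ((hdg Q).1.pow 2)
    calc ∫ ω, (∑ j ∈ I, g (X j ω)) ^ 2 ∂μ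
        ≤ ∫ ω, ((1 + η) * (∑ j ∈ I, hermitePartialSum g Q (X j ω)) ^ 2 +
          (1 + η⁻¹) * ((I.card : ℝ) *
            ∑ j ∈ I, (g (X j ω) - hermitePartialSum g Q (X j ω)) ^ 2)) ∂μ := by
          refine integral_mono (memLp_finsetSum I fun j _ => hgX j).integrable_sq
            ((i1.const_mul _).fun_add ((i3.const_mul _).const_mul _)) fun ω => ?_
          have h1 : (∑ j ∈ I, (g (X j ω) - hermitePartialSum g Q (X j ω))) ^ 2 ≤
              (I.card : ℝ) * ∑ j ∈ I, (g (X j ω) - hermitePartialSum g Q (X j ω)) ^ 2 :=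
            sq_sum_le_card_mul_sum_sq
          have h2 : ∑ j ∈ I, g (X j ω) = ∑ j ∈ I, hermitePartialSum g Q (X j ω) +
              ∑ j ∈ I, (g (X j ω) - hermitePartialSum g Q (X j ω)) := by
            rw [← Finset.sum_add_distrib]; simp
          simp only [h2]
          set a := ∑ j ∈ I, hermitePartialSum g Q (X j ω)
          set b := ∑ j ∈ I, (g (X j ω) - hermitePartialSum g Q (X j ω))
          have h4 : (a + b) ^ 2 ≤ (1 + η) * a ^ 2 + (1 + η⁻¹) * b ^ 2 := by
            have : (1 + η) * a ^ 2 + (1 + η⁻¹) * b ^ 2 - (a + b) ^ 2 = η⁻¹ * (η * a - b) ^ 2 := by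
              field_simp; ring
            have h5 : 0 ≤ η⁻¹ * (η * a - b) ^ 2 := by positivity
            linarith
          have h6 : (1 + η⁻¹) * b ^ 2 ≤ (1 + η⁻¹) * ((I.card : ℝ) *
              ∑ j ∈ I, (g (X j ω) - hermitePartialSum g Q (X j ω)) ^ 2) :=
            mul_le_mul_of_nonneg_left h1 (by positivity)
          linarith
      _ ≤ _ := by
          rw [integral_add (i1.const_mul _) ((i3.const_mul _).const_mul _), integral_const_mul,
            integral_const_mul, integral_const_mul, h3]
          gcongr
          exact integral_sq_sum_hermitePartialSum_le hpair hmap I g hg k hg0 Q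
  have key2 (η : ℝ) (hη : 0 < η) : ∫ ω, (∑ j ∈ I, g (X j ω)) ^ 2 ∂μ ≤ (1 + η) * R := by
    have h1 := ((((tendsto_integral_sq_sub_hermitePartialSum g hg).const_mul
      (I.card : ℝ)).const_mul (I.card : ℝ)).const_mul (1 + η⁻¹)).const_add ((1 + η) * R)
    have := ge_of_tendsto h1 (Eventually.of_forall fun Q => key η hη Q)
    simpa using this
  have h1 : Tendsto (fun η : ℝ => (1 + η) * R) (𝓝[>] 0) (𝓝 ((1 + 0) * R)) :=
    ((tendsto_const_nhds.add tendsto_id).mul_const R).mono_left nhdsWithin_le_nhds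
  have := ge_of_tendsto h1 (eventually_nhdsWithin_of_forall fun η hη => key2 η hη)
  simpa using this

/-- Variance of a sum of Hermite polynomials of a Gaussian sequence. -/
theorem integral_sq_sum_hermiteEval
    (hpair : ∀ i j, HasGaussianLaw (fun ω => (X i ω, X j ω)) μ)
    (hmap : ∀ i, μ.map (X i) = stdGaussian1) (I : Finset ι) (m : ℕ) :
    ∫ ω, (∑ j ∈ I, hermiteEval m (X j ω)) ^ 2 ∂μ =
      (m ! : ℝ) * ∑ i ∈ I, ∑ j ∈ I, (∫ ω, X i ω * X j ω ∂μ) ^ m := by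
  have hXm (i : ι) : AEMeasurable (X i) μ := (hpair i i).fst.aemeasurable
  have hH (j : ι) := memLp_comp_of_map_eq (hXm j) (hmap j) _ 2
    (memLp_hermiteEval m 2 (by simp))
  have hint (i j : ι) : Integrable
      (fun ω => hermiteEval m (X i ω) * hermiteEval m (X j ω)) μ :=
    MemLp.integrable_mul (hH i) (hH j)
  simp_rw [sq (∑ j ∈ I, _), Finset.sum_mul_sum]
  rw [integral_finsetSum _ fun i _ => integrable_finsetSum _ fun j _ => hint i j, Finset.mul_sum]
  refine Finset.sum_congr rfl fun i _ => ?_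
  rw [integral_finsetSum _ fun j _ => hint i j, Finset.mul_sum]
  refine Finset.sum_congr rfl fun j _ => ?_
  rw [integral_hermiteEval_mul_of_gaussian_pair (hpair i j) (hmap i) (hmap j), if_pos rfl]

end Sequence

/-! ### Slowly varying functions -/

namespace IsSlowlyVarying

variable {L : ℝ → ℝ}

theorem tendsto_log_sub (hL : IsSlowlyVarying L) (u : ℝ) :
    Tendsto (fun x => Real.log (L (Real.exp (x + u))) - Real.log (L (Real.exp x))) atTop (𝓝 0) := by
  have h1 := (hL.tendsto_ratio (Real.exp u) (Real.exp_pos u)).comp Real.tendsto_exp_atTop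
  have h2 := h1.log one_ne_zero
  rw [Real.log_one] at h2
  have hp := Real.tendsto_exp_atTop.eventually hL.eventually_pos
  have hp2 := (tendsto_atTop_add_const_right atTop u tendsto_id).eventually hp
  refine h2.congr' ?_
  filter_upwards [hp, hp2] with x hx hx2
  simp only [Function.comp, id] at *
  rw [← Real.exp_add, add_comm u x, Real.log_div hx2.ne' hx.ne']

/-- The uniform convergence theorem for slowly varying functions, in additive form. -/
theorem eventually_forall_abs_log_sub_lt (hL : IsSlowlyVarying L) (ε : ℝ) (hε : 0 < ε) :
    ∀ᶠ x in atTop, ∀ u ∈ Set.Icc (0 : ℝ) 1,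
      |Real.log (L (Real.exp (x + u))) - Real.log (L (Real.exp x))| < ε := by
  set h : ℝ → ℝ := fun x => Real.log (L (Real.exp x)) with hh
  have hm : Measurable h := (Real.measurable_log.comp (hL.measurable.comp Real.measurable_exp))
  -- The bad increments at `x`. Pointwise convergence makes their measure tend to zero; length `2`
  -- leaves room for the shift by `u ≤ 1` below.
  let B : ℝ → Set ℝ := fun x => {u | u ∈ Set.Icc (0 : ℝ) 2 ∧ ε / 2 ≤ |h (x + u) - h x|}
  have hB (x : ℝ) : MeasurableSet (B x) :=
    measurableSet_Icc.inter (measurableSet_le measurable_const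
      ((hm.comp (measurable_const_add x)).sub_const _).abs)
  have hlim : Tendsto (fun x => volume (B x)) atTop (𝓝 (volume (∅ : Set ℝ))) := by
    refine tendsto_measure_of_ae_tendsto_indicator atTop MeasurableSet.empty hB
      (measurableSet_Icc (a := (0 : ℝ)) (b := 2)) (by simp)
      (Eventually.of_forall fun x u hu => hu.1) (Eventually.of_forall fun u => ?_)
    have h1 := (Metric.tendsto_nhds.1 (hL.tendsto_log_sub u)) (ε / 2) (by linarith)
    filter_upwards [h1] with x hx
    simp only [Real.dist_eq, sub_zero] at hx
    simp only [B, Set.mem_ofPred_eq, Set.mem_empty_iff_false, iff_false, not_and, not_le]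
    exact fun _ => hx
  rw [measure_empty] at hlim
  have hev : ∀ᶠ x in atTop, volume (B x) < ENNReal.ofReal (1 / 2) :=
    hlim.eventually (gt_mem_nhds (by simp))
  obtain ⟨x₀, hx₀⟩ := eventually_atTop.1 hev
  filter_upwards [eventually_ge_atTop x₀] with x hx u hu
  -- Two bad sets of measure below `1/2` cannot cover an interval of length one. Some `x + v` is
  -- thus close to both `x` and `x + u` in the value of `h`, and the triangle inequality compares
  -- these two.
  have hcover : ¬ Set.Icc u (u + 1) ⊆ B x ∪ (fun v => v - u) ⁻¹' B (x + u) := by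
    intro hsub
    have h1 := measure_mono (μ := volume) hsub
    have h2 : volume (B x ∪ (fun v => v - u) ⁻¹' B (x + u)) < ENNReal.ofReal 1 := by
      calc volume (B x ∪ (fun v => v - u) ⁻¹' B (x + u))
          ≤ volume (B x) + volume ((fun v => v - u) ⁻¹' B (x + u)) := measure_union_le _ _
        _ = volume (B x) + volume (B (x + u)) := by
            rw [(measurePreserving_sub_right volume u).measure_preimage
              (hB (x + u)).nullMeasurableSet]
        _ < ENNReal.ofReal (1 / 2) + ENNReal.ofReal (1 / 2) :=
            ENNReal.add_lt_add (hx₀ x hx) (hx₀ (x + u) (by linarith [hu.1]))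
        _ = ENNReal.ofReal 1 := by
            rw [← ENNReal.ofReal_add (by norm_num) (by norm_num)]; norm_num
    rw [Real.volume_Icc] at h1
    have : u + 1 - u = 1 := by ring
    rw [this] at h1
    exact absurd h1 (not_le.2 h2)
  obtain ⟨v, hv, hvn⟩ := Set.not_subset.1 hcover
  have hv1 : v ∉ B x := fun hh => hvn (Or.inl hh)
  have hv2 : v - u ∉ B (x + u) := fun hh => hvn (Or.inr hh)
  simp only [B, Set.mem_ofPred_eq, Set.mem_Icc, not_and, not_le] at hv1 hv2
  have e1 := hv1 ⟨by linarith [hv.1, hu.1], by linarith [hv.2, hu.2]⟩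
  have e2 := hv2 ⟨by linarith [hv.1], by linarith [hv.2]⟩
  have e3 : x + u + (v - u) = x + v := by ring
  rw [e3] at e2
  rw [abs_lt] at e1 e2 ⊢
  constructor <;> linarith [e1.1, e1.2, e2.1, e2.2]

/-- A slowly varying function grows and decays more slowly than every power. -/
theorem exists_rpow_bounds (hL : IsSlowlyVarying L) (δ : ℝ) (hδ : 0 < δ) :
    ∃ c C t₀ : ℝ, 0 < c ∧ 0 < C ∧ 1 ≤ t₀ ∧
      ∀ t ≥ t₀, c * t ^ (-δ) ≤ L t ∧ L t ≤ C * t ^ δ := by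
  set h : ℝ → ℝ := fun x => Real.log (L (Real.exp x)) with hh
  obtain ⟨x₀, hx₀⟩ := eventually_atTop.1 ((hL.eventually_forall_abs_log_sub_lt δ hδ).and
    ((eventually_ge_atTop 0).and (Real.tendsto_exp_atTop.eventually hL.eventually_pos)))
  have hx0 : 0 ≤ x₀ := (hx₀ x₀ le_rfl).2.1
  -- In logarithmic coordinates each unit step changes `h` by at most `δ`, so `h` has at most linear
  -- growth of slope `δ`; exponentiating gives the powers `t ^ (±δ)`.
  have hstep (n : ℕ) : |h (x₀ + n) - h x₀| ≤ n * δ := by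
    induction n with
    | zero => simp
    | succ n ih =>
      have h1 := (hx₀ (x₀ + n) (by linarith [(Nat.cast_nonneg n : (0 : ℝ) ≤ n)])).1 1 (by simp)
      have e : x₀ + ((n + 1 : ℕ) : ℝ) = x₀ + n + 1 := by push_cast; ring
      rw [e]
      push_cast
      rw [abs_lt] at h1
      rw [abs_le] at ih ⊢
      constructor <;> linarith [h1.1, h1.2, ih.1, ih.2]
  have hbound (x : ℝ) (hx : x₀ ≤ x) : |h x| ≤ |h x₀| + δ + δ * x := by
    have hfl := Nat.floor_le (sub_nonneg.2 hx)
    have hfl2 := Nat.lt_floor_add_one (x - x₀)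
    set n := ⌊x - x₀⌋₊
    have h1 := (hx₀ (x₀ + n) (by linarith [(Nat.cast_nonneg n : (0 : ℝ) ≤ n)])).1 (x - x₀ - n)
      ⟨by linarith, by linarith⟩
    have e : x₀ + n + (x - x₀ - n) = x := by ring
    rw [e] at h1
    have h2 := hstep n
    have h3 : (n : ℝ) * δ ≤ δ * x := by nlinarith
    have h4 : |h x| ≤ |h x - h (x₀ + n)| + |h (x₀ + n) - h x₀| + |h x₀| := by
      calc |h x| = |(h x - h (x₀ + n)) + (h (x₀ + n) - h x₀) + h x₀| := by ring_nf
        _ ≤ _ := abs_add_three _ _ _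
    have h5 : |h x - h (x₀ + n)| < δ := h1
    linarith
  refine ⟨Real.exp (-(|h x₀| + δ)), Real.exp (|h x₀| + δ), Real.exp x₀, Real.exp_pos _,
    Real.exp_pos _, Real.one_le_exp hx0, fun t ht => ?_⟩
  have ht0 : 0 < t := (Real.exp_pos _).trans_le ht
  have hlt : x₀ ≤ Real.log t := (Real.le_log_iff_exp_le ht0).2 ht
  have hpos : 0 < L t := by
    have := (hx₀ _ hlt).2.2
    rwa [Real.exp_log ht0] at this
  have hb := hbound _ hlt
  simp only [hh, Real.exp_log ht0] at hb
  rw [abs_le] at hb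
  rw [Real.rpow_def_of_pos ht0, Real.rpow_def_of_pos ht0, ← Real.exp_add, ← Real.exp_add]
  constructor
  · rw [← Real.le_log_iff_exp_le hpos]
    simp only [hh]
    linarith [hb.1]
  · rw [← Real.log_le_iff_le_exp hpos]
    simp only [hh]
    linarith [hb.2]

end IsSlowlyVarying

/-! ### Sums of powers of the covariances -/

/-- Every distance is attained at most once on each side of `i`. -/
theorem sum_range_dist_le (f : ℕ → ℝ) (hf : ∀ k, 0 ≤ f k) (N i : ℕ) (hi : i < N) :
    ∑ j ∈ Finset.range N, f (Nat.dist i j) ≤ 2 * ∑ k ∈ Finset.range N, f k := by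
  have h1 : ∑ j ∈ Finset.range (i + 1), f (Nat.dist i j) ≤ ∑ k ∈ Finset.range N, f k := by
    have e : ∑ j ∈ Finset.range (i + 1), f (Nat.dist i j) =
        ∑ j ∈ Finset.range (i + 1), f (i + 1 - 1 - j) := by
      refine Finset.sum_congr rfl fun j hj => ?_
      rw [Nat.dist_eq_sub_of_le_right (by simp at hj; omega)]
      simp
    rw [e, Finset.sum_range_reflect]
    exact Finset.sum_le_sum_of_subset_of_nonneg (by simpa using hi) fun _ _ _ => hf _
  have h2 : ∑ j ∈ Finset.Ico (i + 1) N, f (Nat.dist i j) ≤ ∑ k ∈ Finset.range N, f k := by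
    have e : ∑ j ∈ Finset.Ico (i + 1) N, f (Nat.dist i j) =
        ∑ j ∈ (Finset.Ico (i + 1) N).image (fun j => j - i), f j := by
      rw [Finset.sum_image]
      · refine Finset.sum_congr rfl fun j hj => ?_
        rw [Nat.dist_eq_sub_of_le (by simp at hj; omega)]
      · intro a ha b hb hab
        simp at ha hb hab
        omega
    rw [e]
    refine Finset.sum_le_sum_of_subset_of_nonneg ?_ fun _ _ _ => hf _
    intro k hk
    simp only [Finset.mem_image, Finset.mem_Ico, Finset.mem_range] at hk ⊢
    omega
  rw [Finset.range_eq_Ico, ← Finset.sum_Ico_consecutive _ (Nat.zero_le (i + 1)) hi,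
    ← Finset.range_eq_Ico, ← Finset.range_eq_Ico]
  linarith

theorem sum_range_rpow_neg_le (a : ℝ) (ha0 : 0 ≤ a) (ha1 : a < 1) (N : ℕ) :
    ∑ k ∈ Finset.range N, ((k : ℝ) + 1) ^ (-a) ≤ (N : ℝ) ^ (1 - a) / (1 - a) := by
  induction N with
  | zero => simp; rw [Real.zero_rpow (by linarith)]; simp
  | succ N ih =>
    rw [Finset.sum_range_succ]
    have hN : (0 : ℝ) < (N : ℝ) + 1 := by positivity
    -- Bernoulli's inequality for the exponent `1 - a ≤ 1`: the increment of `N^(1-a)` dominates `(1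
    -- - a)(N + 1)^(-a)`.
    have hb := rpow_one_add_le_one_add_mul_self (s := -1 / ((N : ℝ) + 1)) (p := 1 - a)
      (by rw [le_div_iff₀ hN]; linarith [(Nat.cast_nonneg N : (0 : ℝ) ≤ N)]) (by linarith)
      (by linarith)
    have e1 : 1 + -1 / ((N : ℝ) + 1) = N / ((N : ℝ) + 1) := by field_simp; ring
    rw [e1, Real.div_rpow (by positivity) hN.le] at hb
    have hpos : 0 < ((N : ℝ) + 1) ^ (1 - a) := Real.rpow_pos_of_pos hN _
    rw [div_le_iff₀ hpos] at hb
    have e2 : ((N : ℝ) + 1) ^ (-a) = ((N : ℝ) + 1) ^ (1 - a) / ((N : ℝ) + 1) := by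
      rw [← Real.rpow_sub_one hN.ne']; ring_nf
    push_cast
    rw [le_div_iff₀ (by linarith)] at ih ⊢
    rw [add_mul, e2]
    have e3 : (1 + (1 - a) * (-1 / ((N : ℝ) + 1))) * ((N : ℝ) + 1) ^ (1 - a) =
      ((N : ℝ) + 1) ^ (1 - a) - ((N : ℝ) + 1) ^ (1 - a) / ((N : ℝ) + 1) * (1 - a) := by
      field_simp; ring
    rw [e3] at hb
    linarith

section Covariance

variable {L : ℝ → ℝ} {D : ℝ} {r : ℕ → ℝ}

theorem exists_sum_abs_pow_le (hL : IsSlowlyVarying L) (hr1 : ∀ k, |r k| ≤ 1)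
    (hr : ∀ k : ℕ, 1 ≤ k → r k = (k : ℝ) ^ (-D) * L k) (n : ℕ) (hn : 1 ≤ n)
    (a : ℝ) (ha0 : 0 ≤ a) (ha1 : a < 1) (ha : a < n * D) :
    ∃ C : ℝ, 0 < C ∧ ∀ N : ℕ,
      ∑ k ∈ Finset.range N, |r k| ^ n ≤ C * (N : ℝ) ^ (1 - a) := by
  have hn0 : (0 : ℝ) < n := by exact_mod_cast hn
  -- This exponent makes `|r k|` at most a multiple of `k^(-a/n)`, so that its `n`-th power decays
  -- like `k^(-a)`. Lags below the threshold are covered by `|r k| ≤ 1`.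
  obtain ⟨c, C, t₀, hc, hC, ht₀, hb⟩ := hL.exists_rpow_bounds (D - a / n)
    (by rw [sub_pos, div_lt_iff₀ hn0]; linarith)
  have h2a : (0 : ℝ) < 2 ^ a := by positivity
  obtain ⟨T, hT⟩ := exists_nat_gt t₀
  have hT0 : (0 : ℝ) < (T : ℝ) ^ a := Real.rpow_pos_of_pos (by linarith) _
  set M := max ((T : ℝ) ^ a) (C ^ n * 2 ^ a) with hM
  have hM0 : 0 < M := lt_max_of_lt_left hT0
  have key (k : ℕ) : |r k| ^ n ≤ M * ((k : ℝ) + 1) ^ (-a) := by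
    have hk1 : (0 : ℝ) < (k : ℝ) + 1 := by positivity
    rcases lt_or_ge k T with hk | hk
    · have h1 : |r k| ^ n ≤ 1 := pow_le_one₀ (abs_nonneg _) (hr1 k)
      have h2 : ((k : ℝ) + 1) ^ a ≤ M := by
        refine le_trans (Real.rpow_le_rpow hk1.le ?_ ha0) (le_max_left _ _)
        exact_mod_cast hk
      rw [Real.rpow_neg hk1.le, ← div_eq_mul_inv, le_div_iff₀ (Real.rpow_pos_of_pos hk1 _)]
      nlinarith [Real.rpow_pos_of_pos hk1 a]
    · have hkt : t₀ ≤ k := hT.le.trans (by exact_mod_cast hk)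
      have hk0 : (0 : ℝ) < k := by linarith
      have hk1' : (1 : ℝ) ≤ k := by linarith
      obtain ⟨hl, hu⟩ := hb k hkt
      have hLk : 0 ≤ L k := le_trans (by positivity) hl
      have e1 : |r k| ≤ C * (k : ℝ) ^ (-(a / n)) := by
        rw [hr k (by exact_mod_cast hk1'), abs_of_nonneg (by positivity)]
        calc (k : ℝ) ^ (-D) * L k ≤ (k : ℝ) ^ (-D) * (C * (k : ℝ) ^ (D - a / n)) :=
              mul_le_mul_of_nonneg_left hu (by positivity)
          _ = C * (k : ℝ) ^ (-(a / n)) := by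
              rw [mul_left_comm, ← Real.rpow_add hk0]; ring_nf
      calc |r k| ^ n ≤ (C * (k : ℝ) ^ (-(a / n))) ^ n := pow_le_pow_left₀ (abs_nonneg _) e1 n
        _ = C ^ n * (k : ℝ) ^ (-a) := by
            rw [mul_pow, ← Real.rpow_mul_natCast hk0.le]
            congr 2; field_simp
        _ ≤ C ^ n * (((k : ℝ) + 1) / 2) ^ (-a) := by
            refine mul_le_mul_of_nonneg_left ?_ (by positivity)
            exact Real.rpow_le_rpow_of_nonpos (by positivity) (by linarith) (by linarith)
        _ = C ^ n * 2 ^ a * ((k : ℝ) + 1) ^ (-a) := by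
            rw [Real.div_rpow hk1.le (by norm_num), Real.rpow_neg (by norm_num : (0 : ℝ) ≤ 2)]
            field_simp
        _ ≤ M * ((k : ℝ) + 1) ^ (-a) :=
            mul_le_mul_of_nonneg_right (le_max_right _ _) (by positivity)
  refine ⟨M / (1 - a), div_pos hM0 (by linarith), fun N => ?_⟩
  calc ∑ k ∈ Finset.range N, |r k| ^ n ≤ ∑ k ∈ Finset.range N, M * ((k : ℝ) + 1) ^ (-a) :=
        Finset.sum_le_sum fun k _ => key k
    _ = M * ∑ k ∈ Finset.range N, ((k : ℝ) + 1) ^ (-a) := by rw [Finset.mul_sum]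
    _ ≤ M * ((N : ℝ) ^ (1 - a) / (1 - a)) :=
        mul_le_mul_of_nonneg_left (sum_range_rpow_neg_le a ha0 ha1 N) hM0.le
    _ = _ := by ring

/-- Distant lags contribute at least a multiple of `N^(-b)` each. The lags below a fixed `T` have no
known sign, but there are at most `2T` of them in a row; their total `O(N)` is negligible against
`N^(2-b)` since `b < 1`. -/
theorem exists_le_sum_sum_pow (hL : IsSlowlyVarying L) (hr1 : ∀ k, |r k| ≤ 1)
    (hr : ∀ k : ℕ, 1 ≤ k → r k = (k : ℝ) ^ (-D) * L k) (m : ℕ) (hm : 1 ≤ m)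
    (b : ℝ) (hb0 : 0 ≤ b) (hb1 : b < 1) (hb : m * D < b) :
    ∃ c : ℝ, 0 < c ∧ ∃ N₁ : ℕ, ∀ N ≥ N₁,
      c * (N : ℝ) ^ (2 - b) ≤
        ∑ i ∈ Finset.range N, ∑ j ∈ Finset.range N, r (Nat.dist i j) ^ m := by
  have hm0 : (0 : ℝ) < m := by exact_mod_cast hm
  obtain ⟨c, C, t₀, hc, hC, ht₀, hbd⟩ := hL.exists_rpow_bounds (b / m - D)
    (by rw [sub_pos, lt_div_iff₀ hm0]; linarith)
  obtain ⟨T, hT⟩ := exists_nat_gt t₀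
  have hfar (k : ℕ) (hk : T ≤ k) : c ^ m * (k : ℝ) ^ (-b) ≤ r k ^ m := by
    have hkt : t₀ ≤ k := hT.le.trans (by exact_mod_cast hk)
    have hk0 : (0 : ℝ) < k := by linarith
    have hk1' : (1 : ℝ) ≤ k := by linarith
    have e1 : c * (k : ℝ) ^ (-(b / m)) ≤ r k := by
      rw [hr k (by exact_mod_cast hk1')]
      calc c * (k : ℝ) ^ (-(b / m)) = (k : ℝ) ^ (-D) * (c * (k : ℝ) ^ (-(b / m - D))) := by
            rw [mul_left_comm, ← Real.rpow_add hk0]; ring_nf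
        _ ≤ _ := mul_le_mul_of_nonneg_left (hbd k hkt).1 (by positivity)
    calc c ^ m * (k : ℝ) ^ (-b) = (c * (k : ℝ) ^ (-(b / m))) ^ m := by
            rw [mul_pow, ← Real.rpow_mul_natCast hk0.le]
            congr 2; field_simp
      _ ≤ _ := pow_le_pow_left₀ (by positivity) e1 m
  set q := c ^ m with hq
  have hq0 : 0 < q := by positivity
  -- The penalty `1 + q` pays for the worst near lag: `r^m ≥ -1`, while `q N^(-b) ≤ q`.
  have key (N i j : ℕ) (hi : i < N) (hj : j < N) :
      q * (N : ℝ) ^ (-b) - (1 + q) * (if Nat.dist i j < T then 1 else 0) ≤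
        r (Nat.dist i j) ^ m := by
    have hN : (0 : ℝ) < N := by exact_mod_cast (by omega : 0 < N)
    have hN1 : (1 : ℝ) ≤ N := by exact_mod_cast (by omega : 1 ≤ N)
    split_ifs with h
    · have h1 : |r (Nat.dist i j) ^ m| ≤ 1 := by
        rw [abs_pow]; exact pow_le_one₀ (abs_nonneg _) (hr1 _)
      have h2 : (N : ℝ) ^ (-b) ≤ 1 := Real.rpow_le_one_of_one_le_of_nonpos hN1 (by linarith)
      have := (abs_le.1 h1).1
      nlinarith
    · push Not at h
      have hd : Nat.dist i j ≤ N := by unfold Nat.dist; omega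
      have hd0 : (0 : ℝ) < (Nat.dist i j : ℕ) := by
        have : (T : ℝ) ≤ (Nat.dist i j : ℕ) := by exact_mod_cast h
        linarith
      have := Real.rpow_le_rpow_of_nonpos hd0 (by exact_mod_cast hd : ((Nat.dist i j : ℕ) : ℝ) ≤ N)
        (by linarith : -b ≤ 0)
      calc q * (N : ℝ) ^ (-b) - (1 + q) * 0 = q * (N : ℝ) ^ (-b) := by ring
        _ ≤ q * ((Nat.dist i j : ℕ) : ℝ) ^ (-b) := mul_le_mul_of_nonneg_left this hq0.le
        _ ≤ _ := hfar _ h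
  have hsum (N : ℕ) : q * (N : ℝ) ^ (2 - b) - (1 + q) * (2 * T) * N ≤
      ∑ i ∈ Finset.range N, ∑ j ∈ Finset.range N, r (Nat.dist i j) ^ m := by
    rcases Nat.eq_zero_or_pos N with rfl | hN
    · simp; rw [Real.zero_rpow (by linarith)]; simp
    have hN0 : (0 : ℝ) < N := by exact_mod_cast hN
    have hrow (i : ℕ) (hi : i < N) : q * (N : ℝ) ^ (1 - b) - (1 + q) * (2 * T) ≤
        ∑ j ∈ Finset.range N, r (Nat.dist i j) ^ m := by
      have h1 : ∑ j ∈ Finset.range N, (if Nat.dist i j < T then (1 : ℝ) else 0) ≤ 2 * T := by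
        refine (sum_range_dist_le (fun k => if k < T then (1 : ℝ) else 0)
          (fun k => by split_ifs <;> norm_num) N i hi).trans ?_
        rw [Finset.sum_ite, Finset.sum_const_zero, add_zero, Finset.sum_const, nsmul_eq_mul,
          mul_one]
        have : ({x ∈ Finset.range N | x < T}).card ≤ T := by
          calc _ ≤ (Finset.range T).card := Finset.card_le_card (by
                intro x; simp)
            _ = T := Finset.card_range T
        have : ((({x ∈ Finset.range N | x < T}).card : ℕ) : ℝ) ≤ T := by exact_mod_cast this
        linarith
      calc q * (N : ℝ) ^ (1 - b) - (1 + q) * (2 * T)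
          ≤ q * (N : ℝ) ^ (1 - b) - (1 + q) *
            ∑ j ∈ Finset.range N, (if Nat.dist i j < T then (1 : ℝ) else 0) := by
            have := mul_le_mul_of_nonneg_left h1 (by positivity : 0 ≤ 1 + q)
            linarith
        _ = ∑ j ∈ Finset.range N, (q * (N : ℝ) ^ (-b) -
              (1 + q) * (if Nat.dist i j < T then (1 : ℝ) else 0)) := by
            rw [Finset.sum_sub_distrib, Finset.sum_const, ← Finset.mul_sum, Finset.card_range,
              nsmul_eq_mul, Real.rpow_sub hN0, Real.rpow_one, Real.rpow_neg hN0.le]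
            ring
        _ ≤ _ := Finset.sum_le_sum fun j hj => key N i j hi (Finset.mem_range.1 hj)
    calc q * (N : ℝ) ^ (2 - b) - (1 + q) * (2 * T) * N
        = ∑ i ∈ Finset.range N, (q * (N : ℝ) ^ (1 - b) - (1 + q) * (2 * T)) := by
          rw [Finset.sum_const, Finset.card_range, nsmul_eq_mul]
          have : (N : ℝ) ^ (2 - b) = N * (N : ℝ) ^ (1 - b) := by
            rw [mul_comm, ← Real.rpow_add_one hN0.ne']; ring_nf
          rw [this]; ring
      _ ≤ _ := Finset.sum_le_sum fun i hi => hrow i (Finset.mem_range.1 hi)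
  refine ⟨q / 2, by positivity, ?_⟩
  have hlim : Tendsto (fun N : ℕ => (N : ℝ) ^ (1 - b)) atTop atTop :=
    (tendsto_rpow_atTop (by linarith)).comp tendsto_natCast_atTop_atTop
  obtain ⟨N₁, hN₁⟩ := eventually_atTop.1 ((hlim.eventually_ge_atTop
    ((1 + q) * (2 * T) / (q / 2))).and (eventually_ge_atTop 1))
  refine ⟨N₁, fun N hN => le_trans ?_ (hsum N)⟩
  obtain ⟨h1, h2⟩ := hN₁ N hN
  have hN0 : (0 : ℝ) < N := by exact_mod_cast h2
  have e : (N : ℝ) ^ (2 - b) = N * (N : ℝ) ^ (1 - b) := by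
    rw [mul_comm, ← Real.rpow_add_one hN0.ne']; ring_nf
  rw [div_le_iff₀ (by positivity)] at h1
  rw [e]
  have := mul_le_mul_of_nonneg_right h1 hN0.le
  linarith

end Covariance

/-! ### Dyadic decomposition of initial segments -/

/-- The indicator that `i` lies in the dyadic block of length `2 ^ k` which the binary expansion
of `n` contributes to `{0, …, n - 1}` (zero if the `k`-th bit of `n` is not set). -/
def dyadicBlock (k n i : ℕ) : ℝ :=
  if n / 2 ^ k % 2 = 1 ∧ i / 2 ^ k + 1 = n / 2 ^ k then 1 else 0

/-- Halving `n` and `i` shifts every level down by one. What remains is level `0`, the single point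
`n - 1`, present exactly when `n` is odd. -/
theorem sum_dyadicBlock (K n i : ℕ) (hn : n < 2 ^ K) :
    ∑ k ∈ Finset.range K, dyadicBlock k n i = if i < n then 1 else 0 := by
  induction K generalizing n i with
  | zero =>
    have : n = 0 := by simpa using hn
    simp [this]
  | succ K ih =>
    rw [Finset.sum_range_succ']
    have e (k : ℕ) : dyadicBlock (k + 1) n i = dyadicBlock k (n / 2) (i / 2) := by
      simp only [dyadicBlock, pow_succ', Nat.div_div_eq_div_mul]
    simp_rw [e]
    rw [ih (n / 2) (i / 2) (by rw [pow_succ'] at hn; omega)]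
    simp only [dyadicBlock, pow_zero, Nat.div_one]
    by_cases h1 : i / 2 < n / 2
    · rw [if_pos h1, if_neg (by omega), if_pos (by omega)]; norm_num
    · rw [if_neg h1]
      by_cases h2 : n % 2 = 1 ∧ i + 1 = n
      · rw [if_pos h2, if_pos (by omega)]; norm_num
      · rw [if_neg h2, if_neg (by omega)]; norm_num

/-- For fixed `k` and `n` the dyadic block is either empty or a fibre of `i ↦ i / 2 ^ k`. -/
theorem dyadicBlock_eq (k n i : ℕ) :
    dyadicBlock k n i =
      if n / 2 ^ k % 2 = 1 then (if i / 2 ^ k = n / 2 ^ k - 1 then 1 else 0) else 0 := by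
  unfold dyadicBlock
  generalize n / 2 ^ k = a
  generalize i / 2 ^ k = b
  split_ifs <;> first | rfl | (exfalso; omega)

/-! ### Cells with small probability -/

/-- A probability measure on the line can be cut into `2 M + 1` ordered cells such that every
closed half-line is a union of cells up to a set of measure at most `1 / M`. -/
theorem exists_cells (ν : Measure ℝ) [IsProbabilityMeasure ν] (M : ℕ) (hM : 1 ≤ M) :
    ∃ I : ℝ → ℕ, Measurable I ∧ (∀ y, I y < 2 * M + 1) ∧
      ∀ x : EReal, ∃ a b : ℕ, a ≤ 2 * M + 1 ∧ b ≤ 2 * M + 1 ∧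
        (∀ y : ℝ, I y < a → (y : EReal) ≤ x) ∧ (∀ y : ℝ, (y : EReal) ≤ x → I y < b) ∧
        ν.real {y | a ≤ I y ∧ I y < b} ≤ 1 / M := by
  have hM0 : (0 : ℝ) < M := by exact_mod_cast hM
  let F : ℝ → ℝ := fun y => ν.real (Set.Iic y)
  let F' : ℝ → ℝ := fun y => ν.real (Set.Iio y)
  -- Using both `F(y)` and its left limit lets the index jump at and just after a large atom, so
  -- that such an atom is isolated in its own cell. The values range over `0, …, 2M`.
  let I : ℝ → ℕ := fun y => ⌊M * F y⌋₊ + ⌊M * F' y⌋₊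
  have hF : Monotone F := fun y z h => measureReal_mono (Set.Iic_subset_Iic.2 h)
  have hF' : Monotone F' := fun y z h => measureReal_mono (Set.Iio_subset_Iio h)
  have hFl : Monotone fun y => ⌊M * F y⌋₊ := fun y z h =>
    Nat.floor_mono (mul_le_mul_of_nonneg_left (hF h) hM0.le)
  have hFl' : Monotone fun y => ⌊M * F' y⌋₊ := fun y z h =>
    Nat.floor_mono (mul_le_mul_of_nonneg_left (hF' h) hM0.le)
  have hI : Monotone I := fun y z h => Nat.add_le_add (hFl h) (hFl' h)
  have hI2 (y : ℝ) : I y < 2 * M + 1 := by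
    have h1 : ⌊M * F y⌋₊ ≤ M := Nat.floor_le_of_le
      (mul_le_of_le_one_right hM0.le measureReal_le_one)
    have h2 : ⌊M * F' y⌋₊ ≤ M := Nat.floor_le_of_le
      (mul_le_of_le_one_right hM0.le measureReal_le_one)
    simp only [I]; omega
  refine ⟨I, hI.measurable, hI2, fun x => ?_⟩
  induction x with
  | bot => exact ⟨0, 0, by omega, by omega, by simp, by simp, by simp⟩
  | top =>
    refine ⟨2 * M + 1, 2 * M + 1, le_rfl, le_rfl, by simp, fun y _ => hI2 y, ?_⟩
    have : {y | 2 * M + 1 ≤ I y ∧ I y < 2 * M + 1} = ∅ := by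
      ext y; simp
    rw [this]; simp
  | coe x =>
    -- If the cell continues to the right of `x`, both floors are constant on it, and it has mass at
    -- most `1 / M`. Otherwise `x` is the last point of its cell and the half-line is exactly a
    -- union of cells.
    by_cases hx : ∃ z, x < z ∧ I z = I x
    · obtain ⟨z, hxz, hz⟩ := hx
      refine ⟨I x, I x + 1, (hI2 x).le, hI2 x, ?_, ?_, ?_⟩
      · intro y hy
        have : y < x := by by_contra hc; exact absurd (hI (not_lt.1 hc)) (not_le.2 hy)
        exact_mod_cast this.le
      · intro y hy
        exact Nat.lt_succ_of_le (hI (by exact_mod_cast hy))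
      have hS : {y | I x ≤ I y ∧ I y < I x + 1} = I ⁻¹' {I x} := by
        ext y; simp only [Set.mem_ofPred_eq, Set.mem_preimage, Set.mem_singleton_iff]; omega
      rw [hS]
      set q := ⌊M * F x⌋₊ with hq
      have hle (y : ℝ) : ⌊M * F' y⌋₊ ≤ ⌊M * F y⌋₊ := Nat.floor_mono
        (mul_le_mul_of_nonneg_left (measureReal_mono Set.Iio_subset_Iic_self) hM0.le)
      have hlt : ⌊M * F x⌋₊ ≤ ⌊M * F' z⌋₊ := Nat.floor_mono
        (mul_le_mul_of_nonneg_left (measureReal_mono fun w hw =>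
          lt_of_le_of_lt (Set.mem_Iic.1 hw) hxz) hM0.le)
      have hx' : ⌊M * F' x⌋₊ = q := by
        have h1 := hFl hxz.le
        have h2 := hFl' hxz.le
        have h3 := hle x
        have h4 := hle z
        simp only [I] at hz h1 h2
        omega
      have hcell (y : ℝ) (hy : I y = I x) : ⌊M * F y⌋₊ = q ∧ ⌊M * F' y⌋₊ = q := by
        rcases le_total x y with h | h
        · have h1 := hFl h
          have h2 := hFl' h
          simp only [I] at hy h1 h2
          omega
        · have h1 := hFl h
          have h2 := hFl' h
          simp only [I] at hy h1 h2
          omega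
      have hIcc (y w : ℝ) (hyw : y ≤ w) (hy : I y = I x) (hw : I w = I x) :
          ν.real (Set.Icc y w) ≤ 1 / M := by
        have h1 : F w = F' y + ν.real (Set.Icc y w) := by
          simp only [F, F']
          rw [← measureReal_union ?_ measurableSet_Icc, Set.Iio_union_Icc_eq_Iic hyw]
          exact Set.disjoint_left.2 fun t ht ht2 => absurd ht2.1 (not_le.2 ht)
        have h2 := (hcell w hw).1
        have h3 := (hcell y hy).2
        have h4 := Nat.lt_floor_add_one (M * F w)
        have h5 := Nat.floor_le (mul_nonneg hM0.le (measureReal_nonneg : 0 ≤ F' y))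
        rw [h2] at h4
        rw [h3] at h5
        rw [le_div_iff₀ hM0]
        nlinarith
      have hmeas : MeasurableSet (I ⁻¹' {I x}) := hI.measurable (measurableSet_singleton _)
      -- The cell may omit its endpoints; compact subsets lie in closed intervals with endpoints in
      -- the cell, where the bound is known, and inner regularity passes to the whole cell.
      have hK : ν (I ⁻¹' {I x}) ≤ ENNReal.ofReal (1 / M) := by
        rw [hmeas.measure_eq_iSup_isCompact]
        refine iSup_le fun K => iSup_le fun hKs => iSup_le fun hKc => ?_
        rcases K.eq_empty_or_nonempty with rfl | hne
        · simp
        have h1 : K ⊆ Set.Icc (sInf K) (sSup K) := fun t ht =>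
          ⟨csInf_le hKc.bddBelow ht, le_csSup hKc.bddAbove ht⟩
        refine (measure_mono h1).trans ?_
        rw [← ofReal_measureReal]
        exact ENNReal.ofReal_le_ofReal (hIcc _ _
          (csInf_le_csSup hne hKc.bddBelow hKc.bddAbove) (hKs (hKc.sInf_mem hne))
            (hKs (hKc.sSup_mem hne)))
      exact ENNReal.toReal_le_of_le_ofReal (by positivity) hK
    · push Not at hx
      refine ⟨I x + 1, I x + 1, hI2 x, hI2 x, ?_, ?_, ?_⟩
      · intro y hy
        by_contra hc
        have hxy : x < y := by simpa using hc
        have h1 : I x ≤ I y := hI hxy.le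
        exact hx y hxy (le_antisymm (Nat.lt_succ_iff.1 hy) h1)
      · intro y hy
        exact Nat.lt_succ_of_le (hI (by exact_mod_cast hy))
      · have : {y | I x + 1 ≤ I y ∧ I y < I x + 1} = ∅ := by
          ext y; simp only [Set.mem_ofPred_eq, Set.mem_empty_iff_false, iff_false]; omega
        rw [this]; simp

/-! ### The remainder of the Hermite expansion -/

/-- The part of the Hermite expansion of `f` of order greater than `m`. -/
noncomputable def hermiteRemainder (m : ℕ) (f : ℝ → ℝ) (x : ℝ) : ℝ :=
  f x - hermitePartialSum f (m + 1) x

section Remainder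

variable {m : ℕ} {f : ℝ → ℝ}

theorem memLp_hermiteRemainder (hf : MemLp f 2 stdGaussian1) :
    MemLp (hermiteRemainder m f) 2 stdGaussian1 :=
  hf.sub (memLp_hermitePartialSum f (m + 1))

theorem integral_hermiteRemainder_mul (hf : MemLp f 2 stdGaussian1) (q : ℕ) (hq : q < m + 1) :
    ∫ x, hermiteRemainder m f x * hermiteEval q x ∂stdGaussian1 = 0 := by
  have hH := memLp_hermiteEval q 2 (by simp)
  simp_rw [hermiteRemainder, sub_mul]
  rw [integral_sub (f := fun x => f x * hermiteEval q x)
    (g := fun x => hermitePartialSum f (m + 1) x * hermiteEval q x) (MemLp.integrable_mul hf hH)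
    (MemLp.integrable_mul (memLp_hermitePartialSum f (m + 1)) hH),
    integral_hermitePartialSum_mul, if_pos hq, sub_self]

theorem integral_sq_hermiteRemainder_le (hf : MemLp f 2 stdGaussian1) :
    ∫ x, hermiteRemainder m f x ^ 2 ∂stdGaussian1 ≤ ∫ x, f x ^ 2 ∂stdGaussian1 := by
  simp_rw [hermiteRemainder]
  rw [integral_sq_sub_hermitePartialSum f hf]
  have : 0 ≤ ∑ q ∈ Finset.range (m + 1),
    (∫ y, f y * hermiteEval q y ∂stdGaussian1) ^ 2 / (q ! : ℝ) :=
    Finset.sum_nonneg fun q _ => by positivity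
  linarith

theorem hermitePartialSum_sub {g : ℝ → ℝ} (hf : MemLp f 2 stdGaussian1)
    (hg : MemLp g 2 stdGaussian1) (Q : ℕ) (x : ℝ) :
    hermitePartialSum (fun y => f y - g y) Q x =
      hermitePartialSum f Q x - hermitePartialSum g Q x := by
  simp_rw [hermitePartialSum]
  rw [← Finset.sum_sub_distrib]
  refine Finset.sum_congr rfl fun q _ => ?_
  have hH := memLp_hermiteEval q 2 (by simp)
  simp_rw [sub_mul]
  rw [integral_sub (f := fun x => f x * hermiteEval q x)
    (g := fun x => g x * hermiteEval q x) (MemLp.integrable_mul hf hH)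
    (MemLp.integrable_mul hg hH)]
  ring

theorem hermiteRemainder_sum {ι : Type*} (s : Finset ι) (u : ι → ℝ → ℝ)
    (hu : ∀ i ∈ s, MemLp (u i) 2 stdGaussian1) (x : ℝ) :
    hermiteRemainder m (fun y => ∑ i ∈ s, u i y) x = ∑ i ∈ s, hermiteRemainder m (u i) x := by
  simp_rw [hermiteRemainder, Finset.sum_sub_distrib]
  congr 1
  simp_rw [hermitePartialSum]
  rw [Finset.sum_comm]
  refine Finset.sum_congr rfl fun q _ => ?_
  simp_rw [Finset.sum_mul]
  have hint (i : ι) (hi : i ∈ s) :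
      Integrable (fun y => u i y * hermiteEval q y) stdGaussian1 :=
    MemLp.integrable_mul (hu i hi) (memLp_hermiteEval q 2 (by simp))
  rw [integral_finsetSum _ hint, Finset.sum_div, Finset.sum_mul]

theorem hermiteRemainder_zero (x : ℝ) : hermiteRemainder m (fun _ => 0) x = 0 := by
  simp [hermiteRemainder, hermitePartialSum]

/-- A function which dominates all normalized Hermite partial sums of order at most `m`. -/
noncomputable def hermiteEnvelope (m : ℕ) (x : ℝ) : ℝ :=
  ∑ q ∈ Finset.range (m + 1), |hermiteEval q x| / Real.sqrt (q ! : ℝ)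

theorem hermiteEnvelope_nonneg (x : ℝ) : 0 ≤ hermiteEnvelope m x :=
  Finset.sum_nonneg fun q _ => by positivity

theorem memLp_hermiteEnvelope : MemLp (hermiteEnvelope m) 2 stdGaussian1 :=
  memLp_finsetSum _ fun q _ => by
    simpa [div_eq_mul_inv] using
      ((memLp_hermiteEval q 2 (by simp)).norm).mul_const (Real.sqrt (q ! : ℝ))⁻¹

/-- By Parseval the `q`-th coefficient is at most `‖f‖ √(q!)`. The envelope does not depend on `f`,
which makes the approximation error uniform over orthants. -/
theorem abs_hermitePartialSum_le (hf : MemLp f 2 stdGaussian1) (x : ℝ) :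
    |hermitePartialSum f (m + 1) x| ≤
      Real.sqrt (∫ y, f y ^ 2 ∂stdGaussian1) * hermiteEnvelope m x := by
  rw [hermitePartialSum, hermiteEnvelope, Finset.mul_sum]
  refine (Finset.abs_sum_le_sum_abs _ _).trans (Finset.sum_le_sum fun q _ => ?_)
  have h1 : (∫ y, f y * hermiteEval q y ∂stdGaussian1) ^ 2 / (q ! : ℝ) ≤
      ∫ y, f y ^ 2 ∂stdGaussian1 :=
    le_hasSum (hasSum_sq_hermiteCoeff f hf) q fun _ _ => by positivity
  have hq : (0 : ℝ) < (q ! : ℝ) := by positivity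
  have h2 : |∫ y, f y * hermiteEval q y ∂stdGaussian1| ≤
      Real.sqrt (∫ y, f y ^ 2 ∂stdGaussian1) * Real.sqrt (q ! : ℝ) := by
    rw [← Real.sqrt_mul (integral_nonneg fun y => sq_nonneg _)]
    refine Real.abs_le_sqrt ?_
    rwa [div_le_iff₀ hq] at h1
  rw [abs_mul, abs_div, abs_of_pos hq]
  calc |∫ y, f y * hermiteEval q y ∂stdGaussian1| / (q ! : ℝ) * |hermiteEval q x|
      ≤ Real.sqrt (∫ y, f y ^ 2 ∂stdGaussian1) * Real.sqrt (q ! : ℝ) / (q ! : ℝ) *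
        |hermiteEval q x| := by gcongr
    _ = _ := by
        rw [mul_div_assoc, Real.sqrt_div_self']
        ring

end Remainder

/-! ### A maximal inequality of Rademacher-Menshov type -/

theorem memLp_indicator_one {A : Set ℝ} (hA : MeasurableSet A) :
    MemLp (A.indicator fun _ => (1 : ℝ)) 2 stdGaussian1 :=
  (memLp_const (1 : ℝ)).indicator hA

theorem integral_sq_indicator_one {A : Set ℝ} (hA : MeasurableSet A) :
    ∫ x, (A.indicator (fun _ => (1 : ℝ)) x) ^ 2 ∂stdGaussian1 = stdGaussian1.real A := by
  rw [← integral_indicator_one hA]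
  congr 1; ext x
  by_cases hx : x ∈ A <;> simp [hx]

section Maximal

variable {Ω : Type*} {p : ℕ}

/-- The points all of whose cell indices are smaller than the prescribed bounds. -/
def lowerBox (cell : Fin p → ℝ → ℕ) (n : Fin p → ℕ) : Set ℝ := {s | ∀ c, cell c s < n c}

/-- The points whose cell indices lie in prescribed dyadic blocks. -/
def dyadicBox (cell : Fin p → ℝ → ℕ) (κ v : Fin p → ℕ) : Set ℝ :=
  {s | ∀ c, cell c s / 2 ^ κ c = v c}

theorem measurableSet_lowerBox {cell : Fin p → ℝ → ℕ} (hcell : ∀ c, Measurable (cell c))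
    (n : Fin p → ℕ) : MeasurableSet (lowerBox cell n) := by
  have : lowerBox cell n = ⋂ c, cell c ⁻¹' {i | i < n c} := by
    ext s; simp [lowerBox]
  rw [this]
  exact MeasurableSet.iInter fun c => hcell c trivial

theorem measurableSet_dyadicBox {cell : Fin p → ℝ → ℕ} (hcell : ∀ c, Measurable (cell c))
    (κ v : Fin p → ℕ) : MeasurableSet (dyadicBox cell κ v) := by
  have : dyadicBox cell κ v = ⋂ c, cell c ⁻¹' {i | i / 2 ^ κ c = v c} := by
    ext s; simp [dyadicBox]
  rw [this]
  exact MeasurableSet.iInter fun c => hcell c trivial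

/-- The levels of the dyadic boxes in time and in the `p` coordinates. -/
def dyadicLevels (p K : ℕ) : Finset (ℕ × (Fin p → ℕ)) :=
  Finset.range K ×ˢ Fintype.piFinset fun _ => Finset.range K

theorem card_dyadicLevels (p K : ℕ) : (dyadicLevels p K).card = K ^ (p + 1) := by
  simp [dyadicLevels, pow_succ']

/-- The sum of the Hermite remainder of a dyadic box over a dyadic block of times. -/
noncomputable def blockSum (X : ℕ → Ω → ℝ) (cell : Fin p → ℝ → ℕ) (m N : ℕ)
    (k v : ℕ × (Fin p → ℕ)) (ω : Ω) : ℝ :=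
  ∑ j ∈ Finset.range N with j / 2 ^ k.1 = v.1,
    hermiteRemainder m ((dyadicBox cell k.2 v.2).indicator fun _ => 1) (X j ω)

/-- The sum of squares which dominates the squares of all partial sums of Hermite remainders of
lower boxes. -/
noncomputable def maximalBound (X : ℕ → Ω → ℝ) (cell : Fin p → ℝ → ℕ) (m K N : ℕ) (ω : Ω) : ℝ :=
  (K : ℝ) ^ (p + 1) * ∑ k ∈ dyadicLevels p K, ∑ v ∈ dyadicLevels p (2 ^ K),
    blockSum X cell m N k v ω ^ 2

theorem maximalBound_nonneg (X : ℕ → Ω → ℝ) (cell : Fin p → ℝ → ℕ) (m K N : ℕ) (ω : Ω) :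
    0 ≤ maximalBound X cell m K N ω := by
  unfold maximalBound; positivity

/-- The product over coordinates of the one-dimensional binary decompositions, multiplied out. -/
theorem indicator_lowerBox_eq_sum (cell : Fin p → ℝ → ℕ) (K : ℕ) (n : Fin p → ℕ)
    (hn : ∀ c, n c < 2 ^ K) (s : ℝ) :
    (lowerBox cell n).indicator (fun _ => (1 : ℝ)) s =
      ∑ κ ∈ Fintype.piFinset fun _ : Fin p => Finset.range K,
        ∏ c, dyadicBlock (κ c) (n c) (cell c s) := by
  rw [← Finset.prod_univ_sum (fun _ => Finset.range K) fun c k => dyadicBlock k (n c) (cell c s)]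
  simp_rw [fun c => sum_dyadicBlock K (n c) (cell c s) (hn c)]
  rw [Finset.prod_ite_zero]
  simp only [lowerBox, Set.indicator, Set.mem_ofPred_eq, Finset.mem_univ, forall_const,
    Finset.prod_const_one]
  congr

theorem prod_dyadicBlock_eq (cell : Fin p → ℝ → ℕ) (κ n : Fin p → ℕ) :
    (fun s => ∏ c, dyadicBlock (κ c) (n c) (cell c s)) =
      if ∀ c, n c / 2 ^ κ c % 2 = 1 then
        (dyadicBox cell κ fun c => n c / 2 ^ κ c - 1).indicator fun _ => (1 : ℝ)
      else fun _ => 0 := by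
  ext s
  simp_rw [dyadicBlock_eq]
  rw [Finset.prod_ite_zero]
  by_cases h : ∀ c, n c / 2 ^ κ c % 2 = 1
  · rw [if_pos h, if_pos (by simpa using h), Finset.prod_ite_zero]
    simp only [dyadicBox, Set.indicator, Set.mem_ofPred_eq, Finset.mem_univ, forall_const,
      Finset.prod_const_one]
    congr
  · rw [if_neg h, if_neg (by simpa using h)]

/-- Pathwise half of the Rademacher-Menshov argument. The binary expansions give one term per level,
either zero or a single block sum. Cauchy-Schwarz over the `K^(p+1)` levels, and enlarging each
square to the sum over all blocks of its level, removes the dependence on `n₀` and `n`. -/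
theorem sq_sum_hermiteRemainder_lowerBox_le (X : ℕ → Ω → ℝ) {cell : Fin p → ℝ → ℕ}
    (hcell : ∀ c, Measurable (cell c)) (m K N n₀ : ℕ) (n : Fin p → ℕ) (hn₀ : n₀ ≤ N)
    (hn₀K : n₀ < 2 ^ K) (hn : ∀ c, n c < 2 ^ K) (ω : Ω) :
    (∑ j ∈ Finset.range n₀,
      hermiteRemainder m ((lowerBox cell n).indicator fun _ => 1) (X j ω)) ^ 2 ≤
        maximalBound X cell m K N ω := by
  let f (κ : Fin p → ℕ) : ℝ → ℝ := fun s => ∏ c, dyadicBlock (κ c) (n c) (cell c s)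
  have hf (κ : Fin p → ℕ) : f κ = if ∀ c, n c / 2 ^ κ c % 2 = 1 then
        (dyadicBox cell κ fun c => n c / 2 ^ κ c - 1).indicator fun _ => (1 : ℝ)
      else fun _ => 0 := prod_dyadicBlock_eq cell κ n
  have hfm (κ : Fin p → ℕ) : MemLp (f κ) 2 stdGaussian1 := by
    rw [hf]
    split_ifs
    · exact memLp_indicator_one (measurableSet_dyadicBox hcell _ _)
    · exact MemLp.zero'
  have hrem (x : ℝ) : hermiteRemainder m ((lowerBox cell n).indicator fun _ => 1) x =
      ∑ κ ∈ Fintype.piFinset fun _ : Fin p => Finset.range K, hermiteRemainder m (f κ) x := by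
    rw [← hermiteRemainder_sum _ f fun κ _ => hfm κ]
    congr 1
    ext s
    exact indicator_lowerBox_eq_sum cell K n hn s
  let W (k : ℕ × (Fin p → ℕ)) : ℝ :=
    ∑ j ∈ Finset.range N, dyadicBlock k.1 n₀ j * hermiteRemainder m (f k.2) (X j ω)
  have hW : ∑ j ∈ Finset.range n₀,
      hermiteRemainder m ((lowerBox cell n).indicator fun _ => 1) (X j ω) =
        ∑ k ∈ dyadicLevels p K, W k := by
    have h1 : ∑ j ∈ Finset.range n₀,
        hermiteRemainder m ((lowerBox cell n).indicator fun _ => 1) (X j ω) =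
          ∑ j ∈ Finset.range N, (if j < n₀ then 1 else 0) *
            hermiteRemainder m ((lowerBox cell n).indicator fun _ => 1) (X j ω) := by
      simp_rw [ite_mul, one_mul, zero_mul]
      rw [← Finset.sum_filter]
      refine Finset.sum_congr ?_ fun _ _ => rfl
      ext j; simp; omega
    rw [h1]
    simp only [W, dyadicLevels]
    rw [Finset.sum_comm]
    refine Finset.sum_congr rfl fun j _ => ?_
    rw [← sum_dyadicBlock K n₀ j hn₀K, hrem, Finset.sum_mul_sum, Finset.sum_product]
  have hWle (k : ℕ × (Fin p → ℕ)) :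
      W k ^ 2 ≤ ∑ v ∈ dyadicLevels p (2 ^ K), blockSum X cell m N k v ω ^ 2 := by
    have h0 : 0 ≤ ∑ v ∈ dyadicLevels p (2 ^ K), blockSum X cell m N k v ω ^ 2 :=
      Finset.sum_nonneg fun v _ => sq_nonneg _
    by_cases h : n₀ / 2 ^ k.1 % 2 = 1 ∧ ∀ c, n c / 2 ^ k.2 c % 2 = 1
    · have hWb : W k = blockSum X cell m N k
          (n₀ / 2 ^ k.1 - 1, fun c => n c / 2 ^ k.2 c - 1) ω := by
        simp only [W, blockSum, hf, if_pos h.2]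
        rw [Finset.sum_filter]
        refine Finset.sum_congr rfl fun j _ => ?_
        rw [dyadicBlock_eq, if_pos h.1]
        split_ifs <;> simp
      rw [hWb]
      refine Finset.single_le_sum
        (f := fun v => blockSum X cell m N k v ω ^ 2) (fun v _ => sq_nonneg _) ?_
      simp only [dyadicLevels, Finset.mem_product, Finset.mem_range, Fintype.mem_piFinset]
      constructor
      · exact lt_of_le_of_lt ((Nat.sub_le _ _).trans (Nat.div_le_self _ _)) hn₀K
      · exact fun c => lt_of_le_of_lt ((Nat.sub_le _ _).trans (Nat.div_le_self _ _)) (hn c)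
    · have hW0 : W k = 0 := by
        refine Finset.sum_eq_zero fun j _ => ?_
        by_cases h1 : n₀ / 2 ^ k.1 % 2 = 1
        · have h2 : ¬ ∀ c, n c / 2 ^ k.2 c % 2 = 1 := fun h2 => h ⟨h1, h2⟩
          rw [hf, if_neg h2, hermiteRemainder_zero, mul_zero]
        · rw [dyadicBlock_eq, if_neg h1, zero_mul]
      rw [hW0]
      simpa using h0
  rw [hW, maximalBound]
  refine (sq_sum_le_card_mul_sum_sq).trans ?_
  rw [card_dyadicLevels]
  push_cast
  gcongr with k _
  exact hWle k

variable [MeasurableSpace Ω] {μ : Measure Ω}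

theorem memLp_blockSum {X : ℕ → Ω → ℝ} (hXm : ∀ i, AEMeasurable (X i) μ)
    (hmap : ∀ i, μ.map (X i) = stdGaussian1) {cell : Fin p → ℝ → ℕ}
    (hcell : ∀ c, Measurable (cell c)) (m N : ℕ) (k v : ℕ × (Fin p → ℕ)) :
    MemLp (blockSum X cell m N k v) 2 μ :=
  memLp_finsetSum _ fun j _ => memLp_comp_of_map_eq (hXm j) (hmap j) _ 2
    (memLp_hermiteRemainder (memLp_indicator_one (measurableSet_dyadicBox hcell _ _)))

theorem integrable_maximalBound {X : ℕ → Ω → ℝ} (hXm : ∀ i, AEMeasurable (X i) μ)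
    (hmap : ∀ i, μ.map (X i) = stdGaussian1) {cell : Fin p → ℝ → ℕ}
    (hcell : ∀ c, Measurable (cell c)) (m K N : ℕ) :
    Integrable (maximalBound X cell m K N) μ :=
  (integrable_finsetSum _ fun k _ => integrable_finsetSum _ fun v _ =>
    (memLp_blockSum hXm hmap hcell m N k v).integrable_sq).const_mul _

theorem sum_measureReal_dyadicBox_le {cell : Fin p → ℝ → ℕ} (hcell : ∀ c, Measurable (cell c))
    (κ : Fin p → ℕ) (s : Finset (Fin p → ℕ)) :
    ∑ v ∈ s, stdGaussian1.real (dyadicBox cell κ v) ≤ 1 := by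
  rw [← measureReal_biUnion_finset ?_ fun v _ => measurableSet_dyadicBox hcell κ v]
  · exact measureReal_le_one
  · intro v _ w _ hvw
    refine Set.disjoint_left.2 fun x hx hy => hvw ?_
    ext c
    rw [← hx c, ← hy c]

/-- A block sum has second moment at most (number of times) × (probability of the box) × `A`. Within
a level the time blocks are disjoint and so are the boxes, so the sum is at most `N * A`. The number
of levels and the Cauchy-Schwarz factor give `K^(p+1)` each. -/
theorem integral_maximalBound_le [IsProbabilityMeasure μ] {X : ℕ → Ω → ℝ} {r : ℕ → ℝ}
    (hpair : ∀ i j, HasGaussianLaw (fun ω => (X i ω, X j ω)) μ)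
    (hmap : ∀ i, μ.map (X i) = stdGaussian1)
    (hr : ∀ i j, ∫ ω, X i ω * X j ω ∂μ = r (Nat.dist i j)) {cell : Fin p → ℝ → ℕ}
    (hcell : ∀ c, Measurable (cell c)) (m K N : ℕ) :
    ∫ ω, maximalBound X cell m K N ω ∂μ ≤
      (K : ℝ) ^ (2 * (p + 1)) * (N * (2 * ∑ k ∈ Finset.range N, |r k| ^ (m + 1))) := by
  have hXm (i : ℕ) : AEMeasurable (X i) μ := (hpair i i).fst.aemeasurable
  set A := 2 * ∑ k ∈ Finset.range N, |r k| ^ (m + 1) with hA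
  have hA0 : 0 ≤ A := by positivity
  have hblock (k v : ℕ × (Fin p → ℕ)) : ∫ ω, blockSum X cell m N k v ω ^ 2 ∂μ ≤
      (({j ∈ Finset.range N | j / 2 ^ k.1 = v.1}).card : ℝ) *
        stdGaussian1.real (dyadicBox cell k.2 v.2) * A := by
    have hm2 := memLp_indicator_one (measurableSet_dyadicBox hcell k.2 v.2)
    set J := {j ∈ Finset.range N | j / 2 ^ k.1 = v.1} with hJ
    have h1 := integral_sq_sum_le_of_hermite_rank hpair hmap J _
      (memLp_hermiteRemainder (m := m) hm2) (m + 1)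
      (fun q hq => integral_hermiteRemainder_mul hm2 q hq)
    have h2 : ∑ i ∈ J, ∑ j ∈ J, |∫ ω, X i ω * X j ω ∂μ| ^ (m + 1) ≤ (J.card : ℝ) * A := by
      rw [← nsmul_eq_mul, ← Finset.sum_const]
      refine Finset.sum_le_sum fun i hi => ?_
      have hiN : i < N := Finset.mem_range.1 (Finset.mem_of_mem_filter i hi)
      simp_rw [hr]
      exact (Finset.sum_le_sum_of_subset_of_nonneg (Finset.filter_subset _ _)
        fun _ _ _ => by positivity).trans
          (sum_range_dist_le (fun k => |r k| ^ (m + 1)) (fun _ => by positivity) N i hiN)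
    have h3 := integral_sq_hermiteRemainder_le (m := m) hm2
    rw [integral_sq_indicator_one (measurableSet_dyadicBox hcell k.2 v.2)] at h3
    calc _ ≤ _ := h1
      _ ≤ (J.card : ℝ) * A * stdGaussian1.real (dyadicBox cell k.2 v.2) :=
          mul_le_mul h2 h3 (integral_nonneg fun _ => sq_nonneg _) (by positivity)
      _ = _ := by ring
  have hint (k v : ℕ × (Fin p → ℕ)) : Integrable (fun ω => blockSum X cell m N k v ω ^ 2) μ :=
    (memLp_blockSum hXm hmap hcell m N k v).integrable_sq
  have hlevel (k : ℕ × (Fin p → ℕ)) :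
      ∫ ω, ∑ v ∈ dyadicLevels p (2 ^ K), blockSum X cell m N k v ω ^ 2 ∂μ ≤ N * A := by
    rw [integral_finsetSum _ fun v _ => hint k v]
    calc ∑ v ∈ dyadicLevels p (2 ^ K), ∫ ω, blockSum X cell m N k v ω ^ 2 ∂μ
        ≤ ∑ v ∈ dyadicLevels p (2 ^ K),
          (({j ∈ Finset.range N | j / 2 ^ k.1 = v.1}).card : ℝ) *
            stdGaussian1.real (dyadicBox cell k.2 v.2) * A :=
          Finset.sum_le_sum fun v _ => hblock k v
      _ = (∑ v ∈ Finset.range (2 ^ K), (({j ∈ Finset.range N | j / 2 ^ k.1 = v}).card : ℝ)) *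
            (∑ v ∈ Fintype.piFinset fun _ : Fin p => Finset.range (2 ^ K),
              stdGaussian1.real (dyadicBox cell k.2 v)) * A := by
          rw [← Finset.sum_mul, dyadicLevels, Finset.sum_mul_sum, Finset.sum_product]
      _ ≤ N * 1 * A := by
          refine mul_le_mul_of_nonneg_right (mul_le_mul ?_
            (sum_measureReal_dyadicBox_le hcell _ _)
            (Finset.sum_nonneg fun _ _ => measureReal_nonneg) (by positivity)) hA0
          have h1 := Finset.sum_card_fiberwise_eq_card_filter (Finset.range N)
            (Finset.range (2 ^ K)) (fun j => j / 2 ^ k.1)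
          have h2 := Finset.card_filter_le (Finset.range N)
            (fun j => j / 2 ^ k.1 ∈ Finset.range (2 ^ K))
          rw [Finset.card_range, ← h1] at h2
          exact_mod_cast h2
      _ = N * A := by ring
  simp_rw [maximalBound]
  rw [integral_const_mul,
    integral_finsetSum _ fun k _ => integrable_finsetSum _ fun v _ => hint k v]
  calc (K : ℝ) ^ (p + 1) * ∑ k ∈ dyadicLevels p K,
        ∫ ω, ∑ v ∈ dyadicLevels p (2 ^ K), blockSum X cell m N k v ω ^ 2 ∂μ
      ≤ (K : ℝ) ^ (p + 1) * ∑ _k ∈ dyadicLevels p K, (N * A) := by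
        gcongr with k _
        exact hlevel k
    _ = _ := by
        rw [Finset.sum_const, card_dyadicLevels, nsmul_eq_mul]
        push_cast
        ring

end Maximal

/-! ### Approximation of orthants by boxes of cells -/

section Interpolation

variable {m : ℕ}

/-- The remainder is not monotone in the set, but the indicator is; the defect comes from the
projection of `B \ A`, whose norm is at most `√δ`. -/
theorem hermiteRemainder_indicator_le {A B : Set ℝ} (hA : MeasurableSet A) (hB : MeasurableSet B)
    (hAB : A ⊆ B) {δ : ℝ} (hδ : stdGaussian1.real (B \ A) ≤ δ) (x : ℝ) :
    hermiteRemainder m (A.indicator fun _ => 1) x ≤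
      hermiteRemainder m (B.indicator fun _ => 1) x + Real.sqrt δ * hermiteEnvelope m x := by
  have hA2 := memLp_indicator_one hA
  have hB2 := memLp_indicator_one hB
  have hd : ∀ y, B.indicator (fun _ => (1 : ℝ)) y - A.indicator (fun _ => (1 : ℝ)) y =
      (B \ A).indicator (fun _ => (1 : ℝ)) y := by
    intro y
    by_cases h1 : y ∈ A
    · simp [h1, hAB h1]
    · by_cases h2 : y ∈ B <;> simp [h1, h2]
  have h1 := abs_hermitePartialSum_le (m := m) (hB2.sub hA2) x
  have h2 : ∫ y, ((B.indicator (fun _ => (1 : ℝ)) - A.indicator (fun _ => (1 : ℝ))) y) ^ 2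
      ∂stdGaussian1 = stdGaussian1.real (B \ A) := by
    simp_rw [Pi.sub_apply, hd]
    exact integral_sq_indicator_one (hB.diff hA)
  rw [h2] at h1
  have h3 : |hermitePartialSum (B.indicator fun _ => 1) (m + 1) x -
      hermitePartialSum (A.indicator fun _ => 1) (m + 1) x| ≤
        Real.sqrt δ * hermiteEnvelope m x := by
    rw [← hermitePartialSum_sub hB2 hA2]
    exact h1.trans (mul_le_mul_of_nonneg_right (Real.sqrt_le_sqrt hδ) (hermiteEnvelope_nonneg x))
  have h4 : A.indicator (fun _ => (1 : ℝ)) x ≤ B.indicator (fun _ => (1 : ℝ)) x :=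
    Set.indicator_le_indicator_of_subset hAB (fun _ => zero_le_one) x
  rw [abs_le] at h3
  rw [hermiteRemainder, hermiteRemainder]
  linarith [h3.2]

theorem sq_sum_hermiteRemainder_le_of_between {A O B : Set ℝ} (hA : MeasurableSet A)
    (hO : MeasurableSet O) (hB : MeasurableSet B) (hAO : A ⊆ O) (hOB : O ⊆ B) {δ : ℝ}
    (hδ0 : 0 ≤ δ) (hδ : stdGaussian1.real (B \ A) ≤ δ) (x : ℕ → ℝ) {n N : ℕ} (hn : n ≤ N) {Z : ℝ}
    (hZA : (∑ j ∈ Finset.range n, hermiteRemainder m (A.indicator fun _ => 1) (x j)) ^ 2 ≤ Z)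
    (hZB : (∑ j ∈ Finset.range n, hermiteRemainder m (B.indicator fun _ => 1) (x j)) ^ 2 ≤ Z) :
    (∑ j ∈ Finset.range n, hermiteRemainder m (O.indicator fun _ => 1) (x j)) ^ 2 ≤
      2 * Z + 2 * δ * (∑ j ∈ Finset.range N, hermiteEnvelope m (x j)) ^ 2 := by
  have hδ1 : stdGaussian1.real (B \ O) ≤ δ :=
    (measureReal_mono (Set.sdiff_subset_sdiff_right hAO)).trans hδ
  have hδ2 : stdGaussian1.real (O \ A) ≤ δ :=
    (measureReal_mono (Set.sdiff_subset_sdiff_left hOB)).trans hδ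
  set V := ∑ j ∈ Finset.range N, hermiteEnvelope m (x j) with hV
  have hVn : ∑ j ∈ Finset.range n, hermiteEnvelope m (x j) ≤ V :=
    Finset.sum_le_sum_of_subset_of_nonneg (by simpa using hn)
      fun _ _ _ => hermiteEnvelope_nonneg _
  have hVs := mul_le_mul_of_nonneg_left hVn (Real.sqrt_nonneg δ)
  have h1 : ∑ j ∈ Finset.range n, hermiteRemainder m (O.indicator fun _ => 1) (x j) ≤
      ∑ j ∈ Finset.range n, hermiteRemainder m (B.indicator fun _ => 1) (x j) +
        Real.sqrt δ * V := by
    have := Finset.sum_le_sum fun j (_ : j ∈ Finset.range n) =>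
      (hermiteRemainder_indicator_le (m := m) hO hB hOB hδ1 (x j))
    rw [Finset.sum_add_distrib, ← Finset.mul_sum] at this
    linarith
  have h2 : ∑ j ∈ Finset.range n, hermiteRemainder m (A.indicator fun _ => 1) (x j) ≤
      ∑ j ∈ Finset.range n, hermiteRemainder m (O.indicator fun _ => 1) (x j) +
        Real.sqrt δ * V := by
    have := Finset.sum_le_sum fun j (_ : j ∈ Finset.range n) =>
      (hermiteRemainder_indicator_le (m := m) hA hO hAO hδ2 (x j))
    rw [Finset.sum_add_distrib, ← Finset.mul_sum] at this
    linarith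
  have hs : (Real.sqrt δ * V) ^ 2 = δ * V ^ 2 := by rw [mul_pow, Real.sq_sqrt hδ0]
  have hZ0 : 0 ≤ Z := (sq_nonneg _).trans hZA
  have hA' := abs_le.1 (Real.abs_le_sqrt hZA)
  have hB' := abs_le.1 (Real.abs_le_sqrt hZB)
  have h3 : |∑ j ∈ Finset.range n, hermiteRemainder m (O.indicator fun _ => 1) (x j)| ≤
      Real.sqrt Z + Real.sqrt δ * V := abs_le.2 ⟨by linarith [hA'.1], by linarith [hB'.2]⟩
  have h4 := pow_le_pow_left₀ (abs_nonneg _) h3 2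
  rw [sq_abs] at h4
  have h5 := Real.sq_sqrt hZ0
  nlinarith [sq_nonneg (Real.sqrt Z - Real.sqrt δ * V)]

end Interpolation

/-- The boxes of cells approximate all orthants simultaneously. -/
theorem exists_cells_orthant {p : ℕ} {G : ℝ → Fin p → ℝ} (hG : Measurable G) (M : ℕ)
    (hM : 1 ≤ M) :
    ∃ cell : Fin p → ℝ → ℕ, (∀ c, Measurable (cell c)) ∧
      ∀ x : Fin p → EReal, ∃ a b : Fin p → ℕ, (∀ c, a c ≤ 2 * M + 1) ∧ (∀ c, b c ≤ 2 * M + 1) ∧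
        lowerBox cell a ⊆ G ⁻¹' lowerOrthant x ∧ G ⁻¹' lowerOrthant x ⊆ lowerBox cell b ∧
          stdGaussian1.real (lowerBox cell b \ lowerBox cell a) ≤ p / M := by
  have hGc (c : Fin p) : Measurable fun s => G s c := (measurable_pi_apply c).comp hG
  have hprob (c : Fin p) : IsProbabilityMeasure (stdGaussian1.map fun s => G s c) :=
    Measure.isProbabilityMeasure_map (hGc c).aemeasurable
  choose I hIm hI2 hIx using fun c => exists_cells (stdGaussian1.map fun s => G s c) M hM
  refine ⟨fun c s => I c (G s c), fun c => (hIm c).comp (hGc c), fun x => ?_⟩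
  choose a b ha hb hle hlt hν using fun c => hIx c (x c)
  refine ⟨a, b, ha, hb, fun s hs c => hle c _ (hs c), fun s hs c => hlt c _ (hs c), ?_⟩
  have hsub : (lowerBox (fun c s => I c (G s c)) b \ lowerBox (fun c s => I c (G s c)) a) ⊆
      ⋃ c, (fun s => G s c) ⁻¹' {y | a c ≤ I c y ∧ I c y < b c} := by
    rintro s ⟨hsb, hsa⟩
    simp only [lowerBox, Set.mem_ofPred_eq, not_forall, not_lt] at hsa hsb
    obtain ⟨c, hc⟩ := hsa
    exact Set.mem_iUnion.2 ⟨c, hc, hsb c⟩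
  calc _ ≤ stdGaussian1.real (⋃ c, (fun s => G s c) ⁻¹' {y | a c ≤ I c y ∧ I c y < b c}) :=
        measureReal_mono hsub
    _ ≤ ∑ c, stdGaussian1.real ((fun s => G s c) ⁻¹' {y | a c ≤ I c y ∧ I c y < b c}) :=
        measureReal_iUnion_fintype_le _
    _ ≤ ∑ _c : Fin p, 1 / (M : ℝ) := by
        refine Finset.sum_le_sum fun c _ => ?_
        rw [← map_measureReal_apply (hGc c)]
        · exact hν c
        · exact hIm c (t := {i | a c ≤ i ∧ i < b c}) trivial
    _ = p / M := by simp [div_eq_mul_inv]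

theorem measurableSet_lowerOrthant {p : ℕ} (x : Fin p → EReal) :
    MeasurableSet (lowerOrthant x) := by
  have : lowerOrthant x = ⋂ i, {y : Fin p → ℝ | (y i : EReal) ≤ x i} := by
    ext y; simp [lowerOrthant]
  rw [this]
  exact MeasurableSet.iInter fun i => measurableSet_le
    (measurable_coe_real_ereal.comp (measurable_pi_apply i)) measurable_const

/-- Uniformly in time and in the orthant, the squares of the partial sums of Hermite remainders
are dominated by one random variable with a small mean. -/
theorem exists_dominating_integrable {Ω : Type*} [MeasurableSpace Ω] {μ : Measure Ω}
    [IsProbabilityMeasure μ] {X : ℕ → Ω → ℝ} {r : ℕ → ℝ} {p : ℕ} {G : ℝ → Fin p → ℝ}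
    (hpair : ∀ i j, HasGaussianLaw (fun ω => (X i ω, X j ω)) μ)
    (hmap : ∀ i, μ.map (X i) = stdGaussian1)
    (hr : ∀ i j, ∫ ω, X i ω * X j ω ∂μ = r (Nat.dist i j)) (hG : Measurable G)
    (m N : ℕ) (hN : 1 ≤ N) :
    ∃ Z : Ω → ℝ, Integrable Z μ ∧ (∀ ω, 0 ≤ Z ω) ∧
      (∀ ω, ∀ n ≤ N, ∀ x : Fin p → EReal,
        (∑ j ∈ Finset.range n, hermiteRemainder m
          ((G ⁻¹' lowerOrthant x).indicator fun _ => 1) (X j ω)) ^ 2 ≤ Z ω) ∧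
      ∫ ω, Z ω ∂μ ≤ 2 * (((2 * Nat.log 2 N + 4 : ℕ) : ℝ) ^ (2 * (p + 1)) *
        (N * (2 * ∑ k ∈ Finset.range N, |r k| ^ (m + 1)))) +
          2 * p * ∫ x, hermiteEnvelope m x ^ 2 ∂stdGaussian1 := by
  have hXm (i : ℕ) : AEMeasurable (X i) μ := (hpair i i).fst.aemeasurable
  have hN0 : (0 : ℝ) < N := by exact_mod_cast hN
  -- With resolution `N²` the error `δ = p / N²` cancels the crude bound `N²` for the second moment
  -- of the summed envelopes, leaving a constant.
  obtain ⟨cell, hcell, hx⟩ := exists_cells_orthant hG (N ^ 2) (Nat.one_le_pow _ _ hN)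
  -- Enough binary digits for the cell bounds, which reach `2N² + 1`, as well as for the times.
  set K := 2 * Nat.log 2 N + 4 with hK
  have hlog : N < 2 ^ (Nat.log 2 N + 1) := Nat.lt_pow_succ_log_self (by norm_num) N
  have hKpow : 2 ^ K = 4 * (2 ^ (Nat.log 2 N + 1)) ^ 2 := by
    rw [hK, ← pow_mul]; ring
  have hK1 : 2 * N ^ 2 + 1 < 2 ^ K := by rw [hKpow]; nlinarith
  have hK2 : N < 2 ^ K := by nlinarith
  have hVm (j : ℕ) : MemLp (fun ω => hermiteEnvelope m (X j ω)) 2 μ :=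
    memLp_comp_of_map_eq (hXm j) (hmap j) _ 2 memLp_hermiteEnvelope
  have hV2 (j : ℕ) : Integrable (fun ω => hermiteEnvelope m (X j ω) ^ 2) μ :=
    (hVm j).integrable_sq
  have hVs : Integrable (fun ω => (∑ j ∈ Finset.range N, hermiteEnvelope m (X j ω)) ^ 2) μ :=
    (memLp_finsetSum _ fun j _ => hVm j).integrable_sq
  have hQ := integrable_maximalBound hXm hmap hcell m K N
  refine ⟨fun ω => 2 * maximalBound X cell m K N ω + 2 * (p / (N ^ 2 : ℕ)) *
    (∑ j ∈ Finset.range N, hermiteEnvelope m (X j ω)) ^ 2,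
    (hQ.const_mul _).fun_add (hVs.const_mul _), fun ω => ?_, fun ω n hn x => ?_, ?_⟩
  · have := maximalBound_nonneg X cell m K N ω
    positivity
  · obtain ⟨a, b, ha, hb, hsa, hsb, hd⟩ := hx x
    refine sq_sum_hermiteRemainder_le_of_between (measurableSet_lowerBox hcell a)
      (hG (measurableSet_lowerOrthant x)) (measurableSet_lowerBox hcell b) hsa hsb
      (by positivity) hd (fun j => X j ω) hn ?_ ?_
    · exact sq_sum_hermiteRemainder_lowerBox_le X hcell m K N n a hn (hn.trans_lt hK2)
        (fun c => (ha c).trans_lt hK1) ω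
    · exact sq_sum_hermiteRemainder_lowerBox_le X hcell m K N n b hn (hn.trans_lt hK2)
        (fun c => (hb c).trans_lt hK1) ω
  · rw [integral_add (hQ.const_mul _) (hVs.const_mul _), integral_const_mul, integral_const_mul]
    have h1 := integral_maximalBound_le hpair hmap hr hcell m K N
    have h2 : ∫ ω, (∑ j ∈ Finset.range N, hermiteEnvelope m (X j ω)) ^ 2 ∂μ ≤
        N ^ 2 * ∫ x, hermiteEnvelope m x ^ 2 ∂stdGaussian1 := by
      calc _ ≤ ∫ ω, (N : ℝ) * ∑ j ∈ Finset.range N, hermiteEnvelope m (X j ω) ^ 2 ∂μ := by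
            refine integral_mono hVs ((integrable_finsetSum _ fun j _ => hV2 j).const_mul _)
              fun ω => ?_
            have := sq_sum_le_card_mul_sum_sq (s := Finset.range N)
              (f := fun j => hermiteEnvelope m (X j ω))
            simpa using this
        _ = (N : ℝ) * ∑ j ∈ Finset.range N, ∫ x, hermiteEnvelope m x ^ 2 ∂stdGaussian1 := by
            rw [integral_const_mul, integral_finsetSum _ fun j _ => hV2 j]
            congr 1
            refine Finset.sum_congr rfl fun j _ => ?_
            exact integral_comp_of_map_eq (hXm j) (hmap j) (fun x => hermiteEnvelope m x ^ 2)
              (memLp_hermiteEnvelope.1.pow 2)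
        _ = _ := by rw [Finset.sum_const, Finset.card_range, nsmul_eq_mul]; ring
    have h3 : 2 * ((p : ℝ) / (N ^ 2 : ℕ)) *
        ∫ ω, (∑ j ∈ Finset.range N, hermiteEnvelope m (X j ω)) ^ 2 ∂μ ≤
          2 * ((p : ℝ) / (N ^ 2 : ℕ)) *
            (N ^ 2 * ∫ x, hermiteEnvelope m x ^ 2 ∂stdGaussian1) :=
      mul_le_mul_of_nonneg_left h2 (by positivity)
    have h4 : 2 * ((p : ℝ) / (N ^ 2 : ℕ)) *
        (N ^ 2 * ∫ x, hermiteEnvelope m x ^ 2 ∂stdGaussian1) =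
          2 * p * ∫ x, hermiteEnvelope m x ^ 2 ∂stdGaussian1 := by
      push_cast
      field_simp
    linarith

/-! ### Hermite coefficients of orthants -/

section Coefficients

variable {Ω : Type*} [MeasurableSpace Ω] {μ : Measure Ω} {p : ℕ} {G : ℝ → Fin p → ℝ}
  {ξ : Ω → ℝ}

theorem indLE_comp (G : ℝ → Fin p → ℝ) (x : Fin p → EReal) (s : ℝ) :
    indLE x (G s) = (G ⁻¹' lowerOrthant x).indicator (fun _ => (1 : ℝ)) s := rfl

theorem jointCDF_eq (hG : Measurable G) (hξ : AEMeasurable ξ μ) (hmap : μ.map ξ = stdGaussian1)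
    (x : Fin p → EReal) :
    jointCDF μ (fun ω => G (ξ ω)) x = stdGaussian1.real (G ⁻¹' lowerOrthant x) := by
  rw [jointCDF, ← hmap, measureReal_def, measureReal_def,
    Measure.map_apply_of_aemeasurable hξ (hG (measurableSet_lowerOrthant x))]
  rfl

/-- The centring by `F(x)` drops out because `H_q` has mean zero for `q ≠ 0`. -/
theorem hermiteCoeff_eq (hG : Measurable G) (hξ : AEMeasurable ξ μ)
    (hmap : μ.map ξ = stdGaussian1) (q : ℕ) (hq : q ≠ 0) (x : Fin p → EReal) :
    hermiteCoeff μ ξ G q x =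
      ∫ s, (G ⁻¹' lowerOrthant x).indicator (fun _ => (1 : ℝ)) s * hermiteEval q s
        ∂stdGaussian1 := by
  have hO := memLp_indicator_one (hG (measurableSet_lowerOrthant x))
  have hH := memLp_hermiteEval q 2 (by simp)
  have hi : Integrable (fun s => (G ⁻¹' lowerOrthant x).indicator (fun _ => (1 : ℝ)) s *
      hermiteEval q s) stdGaussian1 := MemLp.integrable_mul hO hH
  have hi2 : Integrable (fun s => stdGaussian1.real (G ⁻¹' lowerOrthant x) * hermiteEval q s)
      stdGaussian1 := (hH.integrable (by norm_num)).const_mul _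
  have hae : AEStronglyMeasurable (fun s =>
      ((G ⁻¹' lowerOrthant x).indicator (fun _ => (1 : ℝ)) s -
        stdGaussian1.real (G ⁻¹' lowerOrthant x)) * hermiteEval q s) stdGaussian1 :=
    (hO.1.sub aestronglyMeasurable_const).mul hH.1
  rw [hermiteCoeff, jointCDF_eq hG hξ hmap]
  simp_rw [indLE_comp]
  rw [integral_comp_of_map_eq hξ hmap (fun s =>
      ((G ⁻¹' lowerOrthant x).indicator (fun _ => (1 : ℝ)) s -
        stdGaussian1.real (G ⁻¹' lowerOrthant x)) * hermiteEval q s) hae]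
  simp_rw [sub_mul]
  rw [integral_sub hi hi2, integral_const_mul, integral_hermiteEval q hq, mul_zero, sub_zero]

/-- An integrable function with mean zero whose integrals over the preimages of all orthants vanish
has vanishing integrals over the preimages of all Borel sets. -/
theorem setIntegral_preimage_eq_zero {α : Type*} [MeasurableSpace α] {ν : Measure α}
    {T : α → Fin p → ℝ} (hT : Measurable T) {h : α → ℝ} (hh : Integrable h ν)
    (h0 : ∫ s, h s ∂ν = 0)
    (hx : ∀ x : Fin p → ℝ, ∫ s in T ⁻¹' lowerOrthant (fun i => (x i : EReal)), h s ∂ν = 0)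
    {B : Set (Fin p → ℝ)} (hB : MeasurableSet B) : ∫ s in T ⁻¹' B, h s ∂ν = 0 := by
  have hspan : IsCountablySpanning (Set.range (Set.Iic : ℝ → Set ℝ)) := by
    refine ⟨fun n : ℕ => Set.Iic (n : ℝ), fun n => ⟨n, rfl⟩, ?_⟩
    ext y
    simpa using exists_nat_ge y
  have hgen : (MeasurableSpace.pi : MeasurableSpace (Fin p → ℝ)) =
      MeasurableSpace.generateFrom
        (Set.univ.pi '' Set.univ.pi fun _ : Fin p => Set.range (Set.Iic : ℝ → Set ℝ)) := by
    rw [← generateFrom_pi_eq fun _ => hspan, ← borel_eq_generateFrom_Iic ℝ,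
      ← BorelSpace.measurable_eq]
  induction B, hB using MeasurableSpace.induction_on_inter hgen
    (IsPiSystem.pi fun _ => isPiSystem_Iic) with
  | empty => simp
  | basic t ht =>
    obtain ⟨C, hC, rfl⟩ := ht
    choose x hxC using fun i => hC i trivial
    convert! hx x using 3
    ext s
    simp only [Set.mem_preimage, Set.mem_pi, Set.mem_univ, forall_const, lowerOrthant,
      Set.mem_ofPred_eq, EReal.coe_le_coe_iff]
    refine forall_congr' fun i => ?_
    rw [← hxC i, Set.mem_Iic]
  | compl t ht ih =>
    have := integral_add_compl (hT ht) hh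
    rw [ih, h0, zero_add] at this
    exact this
  | iUnion f hd hf ih =>
    rw [Set.preimage_iUnion, integral_iUnion (fun i => hT (hf i))
      (fun i j hij => (hd hij).preimage T) hh.integrableOn]
    simp [ih]

/-- The minimal rank is taken over finite `x`, while the supremum also runs over infinite
coordinates. Finite orthants form a π-system generating the Borel sets, so the vanishing extends. -/
theorem integral_indicator_lowerOrthant_mul_eq_zero (hG : Measurable G) (hξ : AEMeasurable ξ μ)
    (hmap : μ.map ξ = stdGaussian1) {m : ℕ}
    (hm : ∀ x : Fin p → ℝ, (m : ℕ∞) ≤ hermiteRank μ ξ G fun i => (x i : EReal)) (q : ℕ)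
    (hq0 : q ≠ 0) (hq : q < m) (x : Fin p → EReal) :
    ∫ s, (G ⁻¹' lowerOrthant x).indicator (fun _ => (1 : ℝ)) s * hermiteEval q s
      ∂stdGaussian1 = 0 := by
  have hind (y : Fin p → EReal) :
      ∫ s, (G ⁻¹' lowerOrthant y).indicator (fun _ => (1 : ℝ)) s * hermiteEval q s
        ∂stdGaussian1 = ∫ s in G ⁻¹' lowerOrthant y, hermiteEval q s ∂stdGaussian1 := by
    rw [← integral_indicator (hG (measurableSet_lowerOrthant y))]
    congr 1; ext s
    by_cases hs : s ∈ G ⁻¹' lowerOrthant y <;> simp [hs]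
  rw [hind]
  refine setIntegral_preimage_eq_zero hG
    ((memLp_hermiteEval q 2 (by simp)).integrable (by norm_num)) (integral_hermiteEval q hq0)
    (fun y => ?_) (measurableSet_lowerOrthant x)
  rw [← hind, ← hermiteCoeff_eq hG hξ hmap q hq0]
  by_contra hne
  have h1 : hermiteRank μ ξ G (fun i => (y i : EReal)) ≤ (q : ℕ∞) :=
    iInf₂_le q hne
  have h2 := (hm y).trans h1
  exact absurd (Nat.cast_le.1 h2) (not_le.2 hq)

/-- In the expansion up to order `m` the term of order `0` is `F(x)`, those strictly between `0` and
`m` vanish, and the last is the one subtracted in the reduced sum. -/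
theorem reducedSum_eq (X : ℕ → Ω → ℝ) (hG : Measurable G) (hX : AEMeasurable (X 0) μ)
    (hmap : μ.map (X 0) = stdGaussian1) {m : ℕ} (hm0 : m ≠ 0)
    (hm : ∀ x : Fin p → ℝ, (m : ℕ∞) ≤ hermiteRank μ (X 0) G fun i => (x i : EReal)) (n : ℕ)
    (x : Fin p → EReal) (ω : Ω) :
    reducedSum μ X G m n x ω = ∑ j ∈ Finset.range n,
      hermiteRemainder m ((G ⁻¹' lowerOrthant x).indicator fun _ => 1) (X j ω) := by
  rw [reducedSum]
  refine Finset.sum_congr rfl fun j _ => ?_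
  have hO := hG (measurableSet_lowerOrthant x)
  rw [hermiteRemainder, hermitePartialSum, Finset.sum_range_succ, indLE_comp,
    hermiteCoeff_eq hG hX hmap m hm0, jointCDF_eq hG hX hmap,
    Finset.sum_eq_single_of_mem 0 (by simpa using Nat.pos_of_ne_zero hm0)]
  · simp_rw [hermiteEval_zero, mul_one]
    have : ∫ y, (G ⁻¹' lowerOrthant x).indicator (fun _ => (1 : ℝ)) y ∂stdGaussian1 =
        stdGaussian1.real (G ⁻¹' lowerOrthant x) := integral_indicator_one hO
    rw [this]
    simp
    ring
  · intro q hq hq0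
    rw [integral_indicator_lowerOrthant_mul_eq_zero hG hX hmap hm q hq0 (Finset.mem_range.1 hq) x]
    simp

end Coefficients

/-! ### Covariances of the stationary sequence -/

section Stationary

variable {Ω : Type*} [MeasurableSpace Ω] {μ : Measure Ω} {X : ℕ → Ω → ℝ}

theorem IsStationarySeq.map_eq (hStat : IsStationarySeq X μ) (j : ℕ) :
    μ.map (X j) = μ.map (X 0) := by
  have := ((hStat j).comp (measurable_pi_apply 0)).map_eq
  simpa [Function.comp_def] using this

theorem IsStationarySeq.integral_mul (hStat : IsStationarySeq X μ) (i j : ℕ) :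
    ∫ ω, X i ω * X j ω ∂μ = ∫ ω, X 0 ω * X (Nat.dist i j) ω ∂μ := by
  have key (i k : ℕ) : ∫ ω, X i ω * X (k + i) ω ∂μ = ∫ ω, X 0 ω * X k ω ∂μ := by
    have hmeas : Measurable fun z : ℕ → ℝ => z 0 * z k := by fun_prop
    have := ((hStat i).comp hmeas).integral_eq
    simpa [Function.comp_def] using this
  rcases le_total i j with h | h
  · rw [Nat.dist_eq_sub_of_le h, ← key i (j - i), Nat.sub_add_cancel h]
  · rw [Nat.dist_eq_sub_of_le_right h, ← key j (i - j), Nat.sub_add_cancel h]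
    exact integral_congr_ae (Eventually.of_forall fun ω => mul_comm _ _)

theorem map_eq_stdGaussian {ξ : Ω → ℝ} (hξ : HasGaussianLaw ξ μ) (hMean : ∫ ω, ξ ω ∂μ = 0)
    (hVar : ∫ ω, ξ ω ^ 2 ∂μ = 1) : μ.map ξ = stdGaussian1 := by
  have := hξ.isProbabilityMeasure
  rw [hξ.map_eq_gaussianReal, hMean, variance_eq_sub hξ.memLp_two, hMean]
  simp [hVar]

theorem sq_normalization [IsProbabilityMeasure μ]
    (hpair : ∀ i j, HasGaussianLaw (fun ω => (X i ω, X j ω)) μ)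
    (hmap : ∀ i, μ.map (X i) = stdGaussian1) (hStat : IsStationarySeq X μ) (m : ℕ) (hm : m ≠ 0)
    (N : ℕ) :
    normalization μ X m N ^ 2 = (m ! : ℝ) * ∑ i ∈ Finset.range N, ∑ j ∈ Finset.range N,
      (∫ ω, X 0 ω * X (Nat.dist i j) ω ∂μ) ^ m := by
  have hXm (i : ℕ) : AEMeasurable (X i) μ := (hpair i i).fst.aemeasurable
  have hH (j : ℕ) := memLp_comp_of_map_eq (hXm j) (hmap j) _ 2
    (memLp_hermiteEval m 2 (by simp))
  rw [normalization, Real.sq_sqrt (variance_nonneg _ _), variance_of_integral_eq_zero,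
    integral_sq_sum_hermiteEval hpair hmap]
  · congr 1
    refine Finset.sum_congr rfl fun i _ => Finset.sum_congr rfl fun j _ => ?_
    rw [hStat.integral_mul i j]
  · exact (memLp_finsetSum _ fun j _ => hH j).1.aemeasurable
  · rw [integral_finsetSum _ fun j _ => (hH j).integrable (by norm_num)]
    refine Finset.sum_eq_zero fun j _ => ?_
    rw [integral_comp_of_map_eq (hXm j) (hmap j) (hermiteEval m)
      (memLp_hermiteEval m 2 (by simp)).1, integral_hermiteEval m hm]

end Stationary

/-- Powers of the logarithm are dominated by every positive power. -/
theorem exists_log_pow_le (n : ℕ) (η : ℝ) (hη : 0 < η) :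
    ∃ C : ℝ, 0 < C ∧ ∀ N : ℕ, 1 ≤ N →
      ((2 * Nat.log 2 N + 4 : ℕ) : ℝ) ^ n ≤ C * (N : ℝ) ^ η := by
  rcases Nat.eq_zero_or_pos n with rfl | hn
  · exact ⟨1, one_pos, fun N hN => by
      simpa using Real.one_le_rpow (by exact_mod_cast hN) hη.le⟩
  have hn0 : (0 : ℝ) < n := by exact_mod_cast hn
  have hl2 : 0 < Real.log 2 := Real.log_pos (by norm_num)
  -- The bound `log N ≤ N^θ / θ`, raised to the power `n`, produces exactly `N^η`.
  set θ := η / n with hθ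
  have hθ0 : 0 < θ := div_pos hη hn0
  refine ⟨(2 / (θ * Real.log 2) + 4) ^ n, by positivity, fun N hN => ?_⟩
  have hN0 : (0 : ℝ) < N := by exact_mod_cast hN
  have h1 : (1 : ℝ) ≤ (N : ℝ) ^ θ := Real.one_le_rpow (by exact_mod_cast hN) hθ0.le
  have h2 : (Nat.log 2 N : ℝ) * Real.log 2 ≤ Real.log N := by
    have := Nat.pow_log_le_self 2 (by omega : N ≠ 0)
    rw [← Real.log_pow]
    exact Real.log_le_log (by positivity) (by exact_mod_cast this)
  have h3 : Real.log N ≤ (N : ℝ) ^ θ / θ := Real.log_le_rpow_div hN0.le hθ0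
  have h4 : (Nat.log 2 N : ℝ) ≤ (N : ℝ) ^ θ / (θ * Real.log 2) := by
    rw [← div_div, le_div_iff₀ hl2]
    linarith
  have h5 : ((2 * Nat.log 2 N + 4 : ℕ) : ℝ) ≤ (2 / (θ * Real.log 2) + 4) * (N : ℝ) ^ θ := by
    push_cast
    have : (2 / (θ * Real.log 2) + 4) * (N : ℝ) ^ θ =
        2 * ((N : ℝ) ^ θ / (θ * Real.log 2)) + 4 * (N : ℝ) ^ θ := by ring
    rw [this]
    linarith
  calc ((2 * Nat.log 2 N + 4 : ℕ) : ℝ) ^ n ≤ ((2 / (θ * Real.log 2) + 4) * (N : ℝ) ^ θ) ^ n :=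
        pow_le_pow_left₀ (by positivity) h5 n
    _ = _ := by
        rw [mul_pow, ← Real.rpow_mul_natCast hN0.le]
        congr 2
        rw [hθ]; field_simp

/-! ### The uniform reduction principle -/

theorem theorem2 {Ω : Type*} [MeasurableSpace Ω] (μ : Measure Ω) [IsProbabilityMeasure μ]
    -- a stationary standard Gaussian sequence, whose first term is `X 0`
    (X : ℕ → Ω → ℝ)
    (hGauss : IsGaussianProcess X μ)
    (hStat : IsStationarySeq X μ)
    (hMean : ∫ ω, X 0 ω ∂μ = 0)
    (hVar : ∫ ω, X 0 ω ^ 2 ∂μ = 1)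
    -- long-range dependence
    (D : ℝ) (L : ℝ → ℝ) (hL : IsSlowlyVarying L)
    (hCov : ∀ k : ℕ, 1 ≤ k → ∫ ω, X 0 ω * X k ω ∂μ = (k : ℝ) ^ (-D) * L k)
    -- the subordinating function
    {p : ℕ} (G : ℝ → Fin p → ℝ) (hG : Measurable G)
    -- `m` is the minimum over `x ∈ ℝᵖ` of the Hermite ranks `m(x)`
    (m : ℕ)
    (hm : IsLeast (Set.range fun x : Fin p → ℝ =>
      hermiteRank μ (X 0) G (fun i => (x i : EReal))) (m : ℕ∞))
    (hD0 : 0 < D) (hD1 : D < 1 / (m : ℝ)) :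
    ∃ C κ : ℝ, 0 < C ∧ 0 < κ ∧
      ∀ N : ℕ, 1 ≤ N → ∀ ε : ℝ, 0 < ε → ε ≤ 1 →
        μ {ω | ENNReal.ofReal ε <
            ⨆ n ∈ Finset.Icc 1 N, ⨆ x : Fin p → EReal,
              ENNReal.ofReal ((normalization μ X m N)⁻¹ * |reducedSum μ X G m n x ω|)}
          ≤ ENNReal.ofReal (C * (N : ℝ) ^ (-κ) * (1 + ε ^ (-3 : ℤ))) := by
  -- For `m = 0` the convention `1 / 0 = 0` makes `hD1` contradict `0 < D`.
  have hmpos : 0 < m := Nat.pos_of_ne_zero fun h => by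
    subst h; simp at hD1; linarith
  have hm0 : m ≠ 0 := hmpos.ne'
  have hmR : (0 : ℝ) < m := by exact_mod_cast hmpos
  have hmD : m * D < 1 := by rw [lt_div_iff₀ hmR] at hD1; linarith
  have hrank : ∀ x : Fin p → ℝ, (m : ℕ∞) ≤ hermiteRank μ (X 0) G fun i => (x i : EReal) :=
    fun x => hm.2 ⟨x, rfl⟩
  have hpair : ∀ i j, HasGaussianLaw (fun ω => (X i ω, X j ω)) μ :=
    fun i j => hGauss.hasGaussianLaw_prodMk
  have hmap0 := map_eq_stdGaussian (hGauss.hasGaussianLaw_eval 0) hMean hVar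
  have hmap : ∀ i, μ.map (X i) = stdGaussian1 := fun i => (hStat.map_eq i).trans hmap0
  have hXm : ∀ i, AEMeasurable (X i) μ := hGauss.aemeasurable
  set r : ℕ → ℝ := fun k => ∫ ω, X 0 ω * X k ω ∂μ with hr
  have hr1 : ∀ k, |r k| ≤ 1 := fun k =>
    abs_integral_mul_le_one (hXm 0) (hXm k) (hmap 0) (hmap k)
  -- the exponents
  obtain ⟨b, hb1, hb2⟩ := exists_between (lt_min hmD (by nlinarith : m * D < (m + 1) * D))
  obtain ⟨a, ha1, ha2⟩ := exists_between hb2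
  rw [lt_min_iff] at ha2
  have hb0 : 0 < b := (mul_pos hmR hD0).trans hb1
  have ha0 : 0 < a := hb0.trans ha1
  obtain ⟨CA, hCA, hA⟩ := exists_sum_abs_pow_le hL hr1 hCov (m + 1) (by omega) a ha0.le ha2.1
    (by push_cast; exact ha2.2)
  obtain ⟨c, hc, N₁, hlow⟩ := exists_le_sum_sum_pow hL hr1 hCov m hmpos b hb0.le
    (ha1.trans ha2.1) hb1
  -- The gap `a - b` is the available power of `N`; half of it absorbs the powers of the logarithm
  -- and half remains as the rate.
  set κ := (a - b) / 2 with hκ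
  have hκ0 : 0 < κ := by linarith [half_pos (sub_pos.2 ha1)]
  obtain ⟨CK, hCK, hK⟩ := exists_log_pow_le (2 * (p + 1)) κ hκ0
  set S := ∫ x, hermiteEnvelope m x ^ 2 ∂stdGaussian1 with hS
  have hS0 : 0 ≤ S := integral_nonneg fun _ => sq_nonneg _
  set C₁ := (4 * CK * CA + 2 * p * S) / ((m ! : ℝ) * c) with hC₁
  have hfac : (0 : ℝ) < (m ! : ℝ) := by positivity
  have hC₁0 : 0 ≤ C₁ := by positivity
  set T := max N₁ 1 with hT
  have hT0 : (0 : ℝ) < T := by exact_mod_cast lt_max_of_lt_right one_pos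
  refine ⟨C₁ + (T : ℝ) ^ κ, κ, by positivity, hκ0, fun N hN ε hε hε1 => ?_⟩
  have hN0 : (0 : ℝ) < N := by exact_mod_cast hN
  have hNκ : 0 < (N : ℝ) ^ (-κ) := Real.rpow_pos_of_pos hN0 _
  have hε3 : 0 < ε ^ (-3 : ℤ) := zpow_pos hε _
  rcases lt_or_ge N T with hNT | hNT
  · -- finitely many `N`: the bound exceeds one
    refine prob_le_one.trans ?_
    rw [← ENNReal.ofReal_one]
    refine ENNReal.ofReal_le_ofReal ?_
    have h1 : (N : ℝ) ^ κ ≤ (T : ℝ) ^ κ :=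
      Real.rpow_le_rpow hN0.le (by exact_mod_cast hNT.le) hκ0.le
    have h2 : (1 : ℝ) ≤ (C₁ + (T : ℝ) ^ κ) * (N : ℝ) ^ (-κ) := by
      rw [Real.rpow_neg hN0.le, ← div_eq_mul_inv, le_div_iff₀ (Real.rpow_pos_of_pos hN0 _)]
      linarith
    nlinarith
  · have hNN₁ : N₁ ≤ N := (le_max_left _ _).trans hNT
    set d := normalization μ X m N with hd
    have hd0 : 0 ≤ d := Real.sqrt_nonneg _
    have hdsq : (m ! : ℝ) * (c * (N : ℝ) ^ (2 - b)) ≤ d ^ 2 := by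
      rw [hd, sq_normalization hpair hmap hStat m hm0 N]
      exact mul_le_mul_of_nonneg_left (hlow N hNN₁) hfac.le
    have hpos : 0 < (m ! : ℝ) * (c * (N : ℝ) ^ (2 - b)) := by positivity
    obtain ⟨Z, hZi, hZ0, hZ, hZint⟩ :=
      exists_dominating_integrable (r := r) hpair hmap hStat.integral_mul hG m N hN
    have hEZ : ∫ ω, Z ω ∂μ ≤ (4 * CK * CA + 2 * p * S) * (N : ℝ) ^ (κ + (2 - a)) := by
      have hexp : 0 ≤ κ + (2 - a) := by linarith [ha2.1]
      have h1 : (1 : ℝ) ≤ (N : ℝ) ^ (κ + (2 - a)) :=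
        Real.one_le_rpow (by exact_mod_cast hN) hexp
      have h2 : ((2 * Nat.log 2 N + 4 : ℕ) : ℝ) ^ (2 * (p + 1)) *
          (N * (2 * ∑ k ∈ Finset.range N, |r k| ^ (m + 1))) ≤
            CK * (N : ℝ) ^ κ * (N * (2 * (CA * (N : ℝ) ^ (1 - a)))) := by
        gcongr
        · exact hK N hN
        · exact hA N
      have h3 : CK * (N : ℝ) ^ κ * (N * (2 * (CA * (N : ℝ) ^ (1 - a)))) =
          2 * CK * CA * (N : ℝ) ^ (κ + (2 - a)) := by
        have : (N : ℝ) ^ (κ + (2 - a)) = (N : ℝ) ^ κ * (N * (N : ℝ) ^ (1 - a)) := by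
          rw [Real.rpow_add hN0, mul_comm (N : ℝ), ← Real.rpow_add_one hN0.ne']
          ring_nf
        rw [this]; ring
      have h4 : 2 * p * S ≤ 2 * p * S * (N : ℝ) ^ (κ + (2 - a)) :=
        le_mul_of_one_le_right (by positivity) h1
      calc ∫ ω, Z ω ∂μ ≤ _ := hZint
        _ ≤ 2 * (2 * CK * CA * (N : ℝ) ^ (κ + (2 - a))) +
            2 * p * S * (N : ℝ) ^ (κ + (2 - a)) := by
            rw [← h3]; gcongr
        _ = _ := by ring
    -- An inclusion suffices, so measurability of the uncountable supremum plays no role.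
    have hsub : {ω | ENNReal.ofReal ε < ⨆ n ∈ Finset.Icc 1 N, ⨆ x : Fin p → EReal,
        ENNReal.ofReal (d⁻¹ * |reducedSum μ X G m n x ω|)} ⊆
          {ω | ε ^ 2 * ((m ! : ℝ) * (c * (N : ℝ) ^ (2 - b))) ≤ Z ω} := by
      intro ω hω
      simp only [Set.mem_ofPred_eq, lt_iSup_iff, Finset.mem_Icc] at hω ⊢
      obtain ⟨n, hn, x, hx⟩ := hω
      have hlt := (ENNReal.ofReal_lt_ofReal_iff_of_nonneg hε.le).1 hx
      -- If `d = 0` then `d⁻¹ = 0`, and the normalized sum could not exceed `ε`.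
      have hdpos : 0 < d := by
        refine lt_of_le_of_ne hd0 fun h => ?_
        rw [← h] at hlt
        simp at hlt
        linarith
      rw [lt_inv_mul_iff₀ hdpos] at hlt
      have h1 := hZ ω n hn.2 x
      rw [← reducedSum_eq X hG (hXm 0) hmap0 hm0 hrank n x ω, ← sq_abs] at h1
      have h2 : (d * ε) ^ 2 ≤ |reducedSum μ X G m n x ω| ^ 2 :=
        pow_le_pow_left₀ (by positivity) hlt.le 2
      calc ε ^ 2 * ((m ! : ℝ) * (c * (N : ℝ) ^ (2 - b))) ≤ ε ^ 2 * d ^ 2 := by gcongr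
        _ = (d * ε) ^ 2 := by ring
        _ ≤ Z ω := h2.trans h1
    refine (measure_mono hsub).trans ?_
    rw [← ofReal_measureReal]
    refine ENNReal.ofReal_le_ofReal ?_
    have hmarkov := mul_meas_ge_le_integral_of_nonneg (Eventually.of_forall hZ0) hZi
      (ε ^ 2 * ((m ! : ℝ) * (c * (N : ℝ) ^ (2 - b))))
    have hprob : μ.real {ω | ε ^ 2 * ((m ! : ℝ) * (c * (N : ℝ) ^ (2 - b))) ≤ Z ω} ≤
        C₁ * (N : ℝ) ^ (-κ) * (ε ^ 2)⁻¹ := by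
      rw [← le_div_iff₀' (by positivity)] at hmarkov
      refine hmarkov.trans ?_
      rw [div_le_iff₀ (by positivity)]
      refine hEZ.trans (le_of_eq ?_)
      have : (N : ℝ) ^ (κ + (2 - a)) = (N : ℝ) ^ (-κ) * (N : ℝ) ^ (2 - b) := by
        rw [← Real.rpow_add hN0]
        congr 1
        rw [hκ]; ring
      rw [this, hC₁]
      field_simp
    -- The second-moment argument yields the better power `ε^(-2)`, which is weakened to the stated
    -- one using `ε ≤ 1`.
    have hε2 : (ε ^ 2)⁻¹ ≤ 1 + ε ^ (-3 : ℤ) := by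
      have : ε ^ (-3 : ℤ) = (ε ^ 3)⁻¹ := by
        rw [zpow_neg]; norm_cast
      rw [this]
      have h1 : (ε ^ 2)⁻¹ ≤ (ε ^ 3)⁻¹ :=
        inv_anti₀ (by positivity) (pow_le_pow_of_le_one hε.le hε1 (by norm_num))
      linarith
    calc _ ≤ _ := hprob
      _ ≤ C₁ * (N : ℝ) ^ (-κ) * (1 + ε ^ (-3 : ℤ)) := by gcongr
      _ ≤ (C₁ + (T : ℝ) ^ κ) * (N : ℝ) ^ (-κ) * (1 + ε ^ (-3 : ℤ)) := by
          gcongr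
          linarith [Real.rpow_nonneg hT0.le κ]
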